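/- **Setting.** Fix $m,n\ge 1$ and work over $\mathbb R$ or $\mathbb C$. An $m\times n$ PEPS $\mathcal T=(T^{(i,j)})$ has one node tensor for each grid position (row $i$, column $j$), with one physical leg and one bond to each neighbouring node; all dimensions are arbitrary. $\mathbf T\neq 0$ is the tensor obtained by summing over all bond indices the product of all nodes, $T^{(\cdot,j)}$ is the tensor obtained by contracting the vertical bonds of column $j$, and $T^{(\cdot,[p,q])}$ is the contraction of columns $p,\dots,q$. $T^{(\cdot,[p,q])}_\rightarrow$ (resp. $_\leftarrow$) is its matricization with the right-going (resp. left-going) legs as column index and all other legs as row index; for $p>q$ it is the identity. The last column $\mathcal T^{(\cdot,n)}$ is also regarded as an MPS with nodes $T^{(1,n)},\dots,T^{(m,n)}$; $T^{([p,q],n)}_\downarrow$ and $T^{([p,q],n)}_\uparrow$ denote the matricizations of the contraction of its nodes $p,\dots,q$ with the down-going, resp. up-going, leg as column index (identity for $p>q$). $\|\cdot\|_F$ is the Frobenius norm, $\|\cdot\|_2$ the spectral norm. A perturbation $(\Delta,\delta)$ replaces the contracted column $T^{(\cdot,j)}$ by $T^{(\cdot,j)}+\Delta^{(j)}$ for $j\le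 n-1$, with $\Delta^{(j)}$ an arbitrary tensor of that shape, and each node $T^{(i,n)}$ of the last column by $T^{(i,n)}+\delta^{(i)}$. It is an $(\epsilon_1,\epsilon_2)$-perturbation if $\|\Delta^{(j)}\|_F\le\epsilon_1\|T^{(\cdot,j)}\|_F$ and $\|\delta^{(i)}\|_F\le\epsilon_2\|T^{(i,n)}\|_F$ for all $j\le n-1$, $i\le m$. Let $\mathscr E_r(\mathcal T,\Delta,\delta)=\|\hat{\mathbf T}-\mathbf T\|_F/\|\mathbf T\|_F$, and let $\mathscr E_r(\mathcal T^{(\cdot,n)},\delta)$ be the relative Frobenius error of the contracted last column under $\delta$. Throughout $0\le\epsilon_1,\epsilon_2\le1$. **General PEPS.** For every such $\mathcal T$ there is a constant, depending on $\mathcal T$ only, such that for all $\epsilon_1,\epsilon_2$ and all $(\epsilon_1,\epsilon_2)$-perturbations $$\mathscr E_r(\mathcal T,\Delta,\delta)\le\epsilon_1\sum_{j=1}^{n-1}\frac{\|T^{(\cdot,[1,j-1])}_\rightarrow\|_2\,\|T^{(\cdot,j)}\|_F\,\|T^{(\cdot,[j+1,n])}_\leftarrow\|_2}{\|\mathbf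 T\|_F}+\mathscr E_r(\mathcal T^{(\cdot,n)},\delta)\,\frac{\|T^{(\cdot,[1,n-1])}_\rightarrow\|_2\,\|T^{(\cdot,n)}\|_F}{\|\mathbf T\|_F}+O(\epsilon_1^2+\epsilon_2^2),$$ $$\mathscr E_r(\mathcal T^{(\cdot,n)},\delta)\le\epsilon_2\sum_{i=1}^{m}\frac{\|T^{([1,i-1],n)}_\downarrow\|_2\,\|T^{(i,n)}\|_F\,\|T^{([i+1,m],n)}_\uparrow\|_2}{\|T^{(\cdot,n)}\|_F}+O(\epsilon_2^2).$$ The bound is tight when $\mathscr E_r(\mathcal T^{(\cdot,n)},\delta)$ is replaced in it by the leading term of the second estimate: for every choice of positive dimensions there is a PEPS $\mathcal T$ with $\mathbf T\ne0$ such that for all $\epsilon_1,\epsilon_2$ some $(\epsilon_1,\epsilon_2)$-perturbation attains it up to an error $O(\epsilon_1^2+\epsilon_2^2)$. **Canonical PEPS.** Let $\mathcal C$ with $\mathbf C\neq0$ be in columnwise canonical form centered at the lower right corner: for $j\le n-1$ the matrix $C^{(\cdot,j)}_\rightarrow$ (column index: the right-going legs) is an isometry, and for $i\le m-1$ the matricization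 of $C^{(i,n)}$ with the down-going leg as column index is an isometry. Let $D_{ij}$ ($j\le n-1$) be the dimension of the bond between nodes $(i,j)$ and $(i,j+1)$ and $D'_i$ ($i\le m-1$) that of the bond between $(i,n)$ and $(i+1,n)$, all bounded by $D$. Then for all $\epsilon_1,\epsilon_2$ and all $(\epsilon_1,\epsilon_2)$-perturbations, up to an error $O(\epsilon_1^2+\epsilon_2^2)$ with a constant depending only on the dimensions, $$\mathscr E_r(\mathcal C,\Delta,\delta)\le\epsilon_1\sum_{j=1}^{n-1}\frac{\bigl(\prod_{i=1}^m D_{ij}^{1/2}\bigr)\|C^{(\cdot,[j+1,n])}_\leftarrow\|_2}{\|\mathbf C\|_F}+\mathscr E_r(\mathcal C^{(\cdot,n)},\delta)\le\epsilon_1(n-1)D^{m/2}+\mathscr E_r(\mathcal C^{(\cdot,n)},\delta)\le\epsilon_1\bigl(1+(n-1)D^{m/2}\bigr)+\mathscr E_r(\mathcal C^{(\cdot,n)},\delta),$$ and, up to $O(\epsilon_2^2)$, $$\mathscr E_r(\mathcal C^{(\cdot,n)},\delta)\le\epsilon_2\Bigl(1+\sum_{i=1}^{m-1}\frac{\sqrt{D'_i}\,\|C^{([i+1,m],n)}_\uparrow\|_2}{\|C^{(\cdot,n)}\|_F}\Bigr)\le\epsilon_2\bigl(1+(m-1)\sqrt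 D\bigr).$$ If all $D_{ij}$ and $D'_i$ equal $D$, all dimensions are positive and the physical dimensions in the first column are at least $D$ (for instance, all dimensions equal $D$), the bounds are tight: there is a canonical PEPS $\mathcal C$ with $\mathbf C\neq0$ such that for all $\epsilon_1,\epsilon_2$ some $(\epsilon_1,\epsilon_2)$-perturbation satisfies, up to $O(\epsilon_1^2+\epsilon_2^2)$, $$\mathscr E_r(\mathcal C,\Delta,\delta)=\epsilon_1\sum_{j=1}^{n-1}\frac{D^{m/2}\|C^{(\cdot,[j+1,n])}_\leftarrow\|_2}{\|\mathbf C\|_F}+\epsilon_2\Bigl(1+\sum_{i=1}^{m-1}\frac{\sqrt D\,\|C^{([i+1,m],n)}_\uparrow\|_2}{\|C^{(\cdot,n)}\|_F}\Bigr)=\epsilon_1(n-1)D^{m/2}+\epsilon_2\bigl(1+(m-1)\sqrt D\bigr).$$ -/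

import Mathlib

open scoped Matrix

noncomputable section

namespace TensorNet

/-! ### Norms -/

/-- Frobenius norm of a tensor, i.e. of a scalar function on its (finite) set of multi-indices. -/
def frob {𝕜 ι : Type*} [RCLike 𝕜] [Fintype ι] (X : ι → 𝕜) : ℝ :=
  ‖WithLp.toLp 2 X‖

/-- Relative error of `Y` as a replacement of `X`. -/
def relErr {𝕜 ι : Type*} [RCLike 𝕜] [Fintype ι] (Y X : ι → 𝕜) : ℝ :=
  frob (Y - X) / frob X

open scoped Matrix.Norms.L2Operator in
/-- The matrix 2-norm (largest singular value). -/
def norm2 {𝕜 r c : Type*} [RCLike 𝕜] [Fintype r] [Fintype c] [DecidableEq c]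
    (M : Matrix r c 𝕜) : ℝ :=
  ‖M‖

/-- Isometric matrix. -/
def IsIsometric {𝕜 r c : Type*} [RCLike 𝕜] [Fintype r] [DecidableEq c]
    (M : Matrix r c 𝕜) : Prop :=
  Mᴴ * M = 1

/-! ### Chains (matrix product states)

A chain of `n` sites has bonds `0, …, n`; site `k` joins bond `k` to bond `k + 1` and carries the
physical leg `k`. Legs are given by their index types: `B k` for bonds, `P k` for physical legs.
An MPS has boundary bonds `0` and `n` of dimension one. -/

/-- The node tensors of a chain; entries are indexed by (left bond, physical leg, right bond). -/
abbrev Chain (𝕜 : Type*) {n : ℕ} (B : Fin (n + 1) → Type) (P : Fin n → Type) : Type _ :=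
  ∀ k : Fin n, B k.castSucc × P k × B k.succ → 𝕜

namespace Chain

variable {𝕜 : Type*} [RCLike 𝕜] {n : ℕ} {B : Fin (n + 1) → Type} {P : Fin n → Type}
  [∀ k, Fintype (B k)] [∀ k, DecidableEq (B k)] [∀ k, Fintype (P k)]

/-- The tensor represented by the chain: the sum over all bond indices of the product of all
nodes. -/
def contract (A : Chain 𝕜 B P) : (∀ k, P k) → 𝕜 := fun p =>
  ∑ b : (∀ k, B k), ∏ k, A k (b k.castSucc, p k, b k.succ)

/-- Contraction of all sites to the left of bond `k`, as a matrix whose column index is bond `k`.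
For `k = 0` there are no sites and this is the identity on the (one-dimensional) boundary bond. -/
def leftBlock (A : Chain 𝕜 B P) (k : Fin (n + 1)) :
    Matrix (∀ i : Fin k.val, P (i.castLE (by omega))) (B k) 𝕜 :=
  Matrix.of fun p y =>
    ∑ b : (∀ i : Fin (k.val + 1), B (i.castLE (by omega))),
      if b (Fin.last k.val) = y then
        ∏ i : Fin k.val, A (i.castLE (by omega)) (b i.castSucc, p i, b i.succ)
      else 0

/-- Contraction of all sites to the right of bond `k`, as a matrix whose column index is bond `k`.
For `k = n` there are no sites and this is the identity on the (one-dimensional) boundary bond. -/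
def rightBlock (A : Chain 𝕜 B P) (k : Fin (n + 1)) :
    Matrix (∀ i : Fin (n - k.val), P ⟨k.val + i.val, by omega⟩) (B k) 𝕜 :=
  Matrix.of fun p x =>
    ∑ b : (∀ i : Fin (n - k.val + 1), B ⟨k.val + i.val, by omega⟩),
      let y : B k := b 0
      if y = x then
        ∏ i : Fin (n - k.val), A ⟨k.val + i.val, by omega⟩ (b i.castSucc, p i, b i.succ)
      else 0

/-- The matricization of node `k` whose column index is the right bond. -/
def toRight (A : Chain 𝕜 B P) (k : Fin n) : Matrix (B k.castSucc × P k) (B k.succ) 𝕜 :=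
  Matrix.of fun x y => A k (x.1, x.2, y)

/-- The product of the norms of site `k` and of its left and right environments. -/
def envTerm (A : Chain 𝕜 B P) (k : Fin n) : ℝ :=
  norm2 (A.leftBlock k.castSucc) * frob (A k) * norm2 (A.rightBlock k.succ)

end Chain

/-! ### PEPS on a rectangular grid -/

/-- Dimensions of the legs of a PEPS with `m + 1` rows and `n + 1` columns. Horizontal bond
`k` of row `i` lies between columns `k - 1` and `k`, vertical bond `k` of column `j` between rows
`k - 1` and `k`. The legs pointing out of the grid are absent, i.e. of dimension one. -/
structure Shape (m n : ℕ) where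
  phys : Fin (m + 1) → Fin (n + 1) → ℕ
  hor : Fin (m + 1) → Fin (n + 2) → ℕ
  ver : Fin (m + 2) → Fin (n + 1) → ℕ
  hor_first : ∀ i, hor i 0 = 1
  hor_last : ∀ i, hor i (Fin.last (n + 1)) = 1
  ver_first : ∀ j, ver 0 j = 1
  ver_last : ∀ j, ver (Fin.last (m + 1)) j = 1

namespace Shape

variable {m n : ℕ} (S : Shape m n)

/-- All legs have positive dimension. -/
def Pos : Prop :=
  (∀ i j, 0 < S.phys i j) ∧ (∀ i k, 0 < S.hor i k) ∧ ∀ k j, 0 < S.ver k j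

/-- Joint index of all horizontal bonds between columns `k - 1` and `k`. -/
abbrev ColBond (k : Fin (n + 2)) : Type := ∀ i : Fin (m + 1), Fin (S.hor i k)

/-- Joint index of all physical legs of column `j`. -/
abbrev ColPhys (j : Fin (n + 1)) : Type := ∀ i : Fin (m + 1), Fin (S.phys i j)

/-- Index of a vertical bond of column `j`. -/
abbrev VerBond (j : Fin (n + 1)) (k : Fin (m + 2)) : Type := Fin (S.ver k j)

/-- Joint index of the legs of node `(i, j)` that are not vertical: (left, physical, right). -/
abbrev RowLegs (j : Fin (n + 1)) (i : Fin (m + 1)) : Type :=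
  Fin (S.hor i j.castSucc) × Fin (S.phys i j) × Fin (S.hor i j.succ)

/-- The nodes of column `j`, as a vertical chain running from the top to the bottom. Node `(i, j)`
is indexed by (up, (left, physical, right), down). -/
abbrev Column (𝕜 : Type*) (j : Fin (n + 1)) : Type _ := Chain 𝕜 (S.VerBond j) (S.RowLegs j)

/-- The nodes of a PEPS, column by column: `T j i` is the node in row `i` and column `j`. -/
abbrev PEPS (𝕜 : Type*) : Type _ := ∀ j : Fin (n + 1), S.Column 𝕜 j

/-- Tensors with the legs of column `j`: (left legs, physical legs, right legs). -/
abbrev ColTensor (𝕜 : Type*) (j : Fin (n + 1)) : Type _ :=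
  S.ColBond j.castSucc × S.ColPhys j × S.ColBond j.succ → 𝕜

end Shape

variable {𝕜 : Type*} [RCLike 𝕜] {m n : ℕ} {S : Shape m n}

/-- The tensor obtained from a column by contracting its vertical bonds. -/
def colTensor {j : Fin (n + 1)} (t : S.Column 𝕜 j) : S.ColTensor 𝕜 j := fun x =>
  Chain.contract t fun i => (x.1 i, x.2.1 i, x.2.2 i)

namespace PEPS

/-- The horizontal chain (MPS) whose nodes are the contracted columns. -/
def columns (T : S.PEPS 𝕜) : Chain 𝕜 S.ColBond S.ColPhys := fun j => colTensor (T j)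

/-- The tensor represented by a PEPS. -/
def tensor (T : S.PEPS 𝕜) : (∀ j, S.ColPhys j) → 𝕜 := Chain.contract (columns T)

/-- The tensor of a PEPS is the sum over all horizontal and vertical bond indices of the product
of all nodes. -/
theorem tensor_apply (T : S.PEPS 𝕜) (p : ∀ j, S.ColPhys j) :
    tensor T p = ∑ h : (∀ k, S.ColBond k), ∑ v : (∀ j k, S.VerBond j k), ∏ j, ∏ i,
      T j i (v j i.castSucc, (h j.castSucc i, p j i, h j.succ i), v j i.succ) := by
  simp only [tensor, Chain.contract, columns, colTensor]
  refine Finset.sum_congr rfl fun h _ => ?_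
  rw [Finset.prod_univ_sum, Fintype.piFinset_univ]

/-- The columns of the PEPS after the tensors `Δ` have been added to all contracted columns but
the last, and the tensors `δ` to the nodes of the last column. -/
def perturbedColumns (T : S.PEPS 𝕜) (Δ : ∀ j : Fin n, S.ColTensor 𝕜 j.castSucc)
    (δ : S.Column 𝕜 (Fin.last n)) : Chain 𝕜 S.ColBond S.ColPhys :=
  Fin.lastCases (colTensor (T (Fin.last n) + δ)) fun j => colTensor (T j.castSucc) + Δ j

/-- `(Δ, δ)` is an `(ε₁, ε₂)`-perturbation of `T`. -/
def IsPerturbation (T : S.PEPS 𝕜) (ε₁ ε₂ : ℝ) (Δ : ∀ j : Fin n, S.ColTensor 𝕜 j.castSucc)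
    (δ : S.Column 𝕜 (Fin.last n)) : Prop :=
  (∀ j, frob (Δ j) ≤ ε₁ * frob (colTensor (T j.castSucc))) ∧
    ∀ i, frob (δ i) ≤ ε₂ * frob (T (Fin.last n) i)

/-- Relative error of the whole PEPS under the perturbation `(Δ, δ)`. -/
def err (T : S.PEPS 𝕜) (Δ : ∀ j : Fin n, S.ColTensor 𝕜 j.castSucc)
    (δ : S.Column 𝕜 (Fin.last n)) : ℝ :=
  relErr (Chain.contract (perturbedColumns T Δ δ)) (tensor T)

/-- Relative error of the last column, as an MPS, under the sitewise perturbation `δ`. -/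
def errLast (T : S.PEPS 𝕜) (δ : S.Column 𝕜 (Fin.last n)) : ℝ :=
  relErr (Chain.contract (T (Fin.last n) + δ)) (Chain.contract (T (Fin.last n)))

/-- Coefficient of `ε₁` in the bound for a general PEPS. -/
def colCoeff (T : S.PEPS 𝕜) : ℝ :=
  ∑ j : Fin n, (columns T).envTerm j.castSucc / frob (tensor T)

/-- Factor by which the error of the last column enters the bound for a general PEPS. -/
def lastFactor (T : S.PEPS 𝕜) : ℝ :=
  norm2 ((columns T).leftBlock (Fin.last n).castSucc) * frob (colTensor (T (Fin.last n))) /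
    frob (tensor T)

/-- Coefficient of `ε₂` in the bound for the last column as a general MPS. -/
def lastCoeff (T : S.PEPS 𝕜) : ℝ :=
  ∑ i : Fin (m + 1), Chain.envTerm (T (Fin.last n)) i / frob (Chain.contract (T (Fin.last n)))

/-- Columnwise canonical form centered at the lower right corner: every column but the last is an
isometry from its right legs, and every node of the last column but the lowest one is an isometry
from its lower leg. -/
def IsCanonical (C : S.PEPS 𝕜) : Prop :=
  (∀ j : Fin n, IsIsometric ((columns C).toRight j.castSucc)) ∧
    ∀ i : Fin m, IsIsometric (Chain.toRight (C (Fin.last n)) i.castSucc)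

/-- Coefficient of `ε₁` in the first bound for a canonical PEPS; `S.hor i j.castSucc.succ` is the
dimension of the bond from node `(i, j)` to its right neighbour. -/
def canonColCoeff (C : S.PEPS 𝕜) : ℝ :=
  ∑ j : Fin n, (∏ i, √(S.hor i j.castSucc.succ : ℝ)) *
    norm2 ((columns C).rightBlock j.castSucc.succ) / frob (tensor C)

/-- Coefficient of `ε₂` in the first bound for the last column as a canonical MPS;
`S.ver i.castSucc.succ (Fin.last n)` is the dimension of the bond below node `i` of this column. -/
def canonLastCoeff (C : S.PEPS 𝕜) : ℝ :=
  1 + ∑ i : Fin m, √(S.ver i.castSucc.succ (Fin.last n) : ℝ) *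
    norm2 (Chain.rightBlock (C (Fin.last n)) i.castSucc.succ) /
      frob (Chain.contract (C (Fin.last n)))

end PEPS

end TensorNet

end

open TensorNet

/-! Contraction is multilinear in the nodes of a chain. Expand the contraction of the perturbed
nodes. In a term with exactly one perturbed node, cutting the chain on both sides of that node
exhibits the term as left block times perturbation times right block, so its Frobenius norm is at
most `‖L‖₂ ‖E k‖_F ‖R‖₂`. All other terms contain at least two perturbed nodes, and a crude
entrywise bound makes them quadratic. This is `Chain.frob_contract_add_sub_le`. It is used twice:
for the last column as a vertical chain, and for the horizontal chain of contracted columns, in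
which the last column is one perturbed node of relative size `errLast = O(ε₂)`.

The quadratic constants involve the nodes only through the ratio of the product of their norms to
the norm of the contraction (and through `lastCoeff`). For a general PEPS these depend on the PEPS.
In canonical form every block to the left of a bond before the center is an isometry; hence the
center carries the whole norm, every other node has the square root of a bond dimension as norm, and
the constants depend on dimensions only. Moreover `‖R‖₂ ≤ ‖R‖_F = ‖L Rᵀ‖_F` bounds every right
environment by the norm of the contraction, which leaves powers of `D`.

Tightness is a sandwich. In a PEPS with `IsBased`, the contraction collapses from its last bond
backwards to a single entry equal to 1. Perturbing only the base entries multiplies it by a product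
of factors `1 + f j` and `1 + g i`, so the error is at least `ε₁ ∑ ‖column‖ + ε₂ ∑ ‖node‖`
(`IsBased.exists_isPerturbation`). In the examples this is at least the leading term of the upper
bound, so equality up to second order follows without computing any environment norm exactly. -/

namespace TensorNet

/-! ### Frobenius norm, spectral norm and isometries -/

section Norms

variable {𝕜 : Type*} [RCLike 𝕜]

section Frob

variable {ι κ : Type*} [Fintype ι] [Fintype κ]

theorem frob_nonneg (X : ι → 𝕜) : 0 ≤ frob X := norm_nonneg _

theorem frob_sq (X : ι → 𝕜) : frob X ^ 2 = ∑ i, ‖X i‖ ^ 2 :=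
  EuclideanSpace.norm_sq_eq _

theorem frob_sq_eq_star_dotProduct (X : ι → 𝕜) : ((frob X ^ 2 : ℝ) : 𝕜) = star X ⬝ᵥ X := by
  rw [frob_sq]
  simp [dotProduct, RCLike.conj_mul]

theorem frob_zero : frob (0 : ι → 𝕜) = 0 := by simp [frob]

theorem frob_pos {X : ι → 𝕜} (hX : X ≠ 0) : 0 < frob X := by
  rw [frob, norm_pos_iff]
  simpa using hX

theorem frob_add_le (X Y : ι → 𝕜) : frob (X + Y) ≤ frob X + frob Y := by
  simpa [frob] using norm_add_le (WithLp.toLp 2 X) (WithLp.toLp 2 Y)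

theorem frob_sum_le {α : Type*} (s : Finset α) (X : α → ι → 𝕜) :
    frob (∑ a ∈ s, X a) ≤ ∑ a ∈ s, frob (X a) := by
  classical
  induction s using Finset.induction_on with
  | empty => simp [frob_zero]
  | insert a s ha ih =>
    rw [Finset.sum_insert ha, Finset.sum_insert ha]
    exact (frob_add_le _ _).trans (by gcongr)

theorem norm_apply_le_frob (X : ι → 𝕜) (i : ι) : ‖X i‖ ≤ frob X :=
  PiLp.norm_apply_le (WithLp.toLp 2 X) i

theorem frob_le_of_sq_le {X : ι → 𝕜} {c : ℝ} (hc : 0 ≤ c) (h : ∑ i, ‖X i‖ ^ 2 ≤ c ^ 2) :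
    frob X ≤ c :=
  le_of_sq_le_sq (by rwa [frob_sq]) hc

theorem frob_eq_of_sq_eq {X : ι → 𝕜} {c : ℝ} (hc : 0 ≤ c) (h : ∑ i, ‖X i‖ ^ 2 = c ^ 2) :
    frob X = c := by
  rw [← frob_sq] at h
  exact (sq_eq_sq₀ (frob_nonneg X) hc).1 h

theorem frob_comp {e : κ → ι} (he : Function.Bijective e) (X : ι → 𝕜) :
    frob (X ∘ e) = frob X := by
  refine frob_eq_of_sq_eq (frob_nonneg X) ?_
  rw [frob_sq]
  exact he.sum_comp fun i => ‖X i‖ ^ 2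

theorem frob_le_of_forall_norm_le {X : ι → 𝕜} {c : ℝ} (hc : 0 ≤ c) (h : ∀ i, ‖X i‖ ≤ c) :
    frob X ≤ √(Fintype.card ι) * c := by
  refine frob_le_of_sq_le (by positivity) ?_
  rw [mul_pow, Real.sq_sqrt (by positivity)]
  calc ∑ i, ‖X i‖ ^ 2 ≤ ∑ _i : ι, c ^ 2 :=
        Finset.sum_le_sum fun i _ => pow_le_pow_left₀ (norm_nonneg _) (h i) 2
    _ = Fintype.card ι * c ^ 2 := by simp

theorem frob_single [DecidableEq ι] (i : ι) (c : 𝕜) : frob (Pi.single i c) = ‖c‖ := by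
  simp [frob]

theorem relErr_nonneg (Y X : ι → 𝕜) : 0 ≤ relErr Y X :=
  div_nonneg (frob_nonneg _) (frob_nonneg _)

end Frob

section Norm2

variable {r c s : Type*} [Fintype r] [Fintype c] [Fintype s] [DecidableEq c]

open scoped Matrix.Norms.L2Operator in
theorem norm2_nonneg (M : Matrix r c 𝕜) : 0 ≤ norm2 M := norm_nonneg M

open scoped Matrix.Norms.L2Operator in
theorem frob_mulVec_le (M : Matrix r c 𝕜) (x : c → 𝕜) :
    frob (M *ᵥ x) ≤ norm2 M * frob x :=
  Matrix.l2_opNorm_mulVec M (WithLp.toLp 2 x)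

/-- Apply the operator norm inequality to each column of the product and sum the squares. Tensors
are functions on product types, so that later regroupings of legs are mere compositions with
bijections (`frob_comp`). -/
theorem frob_mul_le (M : Matrix r c 𝕜) (G : c × s → 𝕜) :
    frob (fun p : r × s => ∑ x, M p.1 x * G (x, p.2)) ≤ norm2 M * frob G := by
  refine frob_le_of_sq_le (mul_nonneg (norm2_nonneg M) (frob_nonneg G)) ?_
  rw [mul_pow, frob_sq, Fintype.sum_prod_type_right, Fintype.sum_prod_type_right, Finset.mul_sum]
  refine Finset.sum_le_sum fun b _ => ?_
  have h := pow_le_pow_left₀ (frob_nonneg _) (frob_mulVec_le M fun x => G (x, b)) 2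
  rw [mul_pow, frob_sq, frob_sq] at h
  exact h

open scoped Matrix.Norms.L2Operator in
theorem norm2_le_frob (M : Matrix r c 𝕜) : norm2 M ≤ frob fun p : r × c => M p.1 p.2 := by
  rw [norm2, Matrix.l2_opNorm_def]
  refine ContinuousLinearMap.opNorm_le_bound _ (frob_nonneg _) fun x => ?_
  change frob (M *ᵥ x.ofLp) ≤ _ * frob x.ofLp
  refine frob_le_of_sq_le (mul_nonneg (frob_nonneg _) (frob_nonneg _)) ?_
  rw [mul_pow, frob_sq, Fintype.sum_prod_type, Finset.sum_mul, frob_sq]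
  refine Finset.sum_le_sum fun i _ => ?_
  calc ‖(M *ᵥ x.ofLp) i‖ ^ 2 ≤ (∑ j, ‖M i j‖ * ‖x.ofLp j‖) ^ 2 := by
        refine pow_le_pow_left₀ (norm_nonneg _) ?_ 2
        simp only [Matrix.mulVec, dotProduct]
        exact (norm_sum_le _ _).trans (by simp)
    _ ≤ _ := Finset.sum_mul_sq_le_sq_mul_sq _ _ _

namespace IsIsometric

variable {M : Matrix r c 𝕜}

theorem frob_mulVec (hM : IsIsometric M) (x : c → 𝕜) : frob (M *ᵥ x) = frob x := by
  have h : ((frob (M *ᵥ x) ^ 2 : ℝ) : 𝕜) = ((frob x ^ 2 : ℝ) : 𝕜) := by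
    rw [frob_sq_eq_star_dotProduct, frob_sq_eq_star_dotProduct, Matrix.star_mulVec,
      ← Matrix.dotProduct_mulVec, Matrix.mulVec_mulVec, hM,
      Matrix.one_mulVec]
  exact (sq_eq_sq₀ (frob_nonneg _) (frob_nonneg _)).1 (RCLike.ofReal_injective h)

theorem norm2_le_one (hM : IsIsometric M) : norm2 M ≤ 1 := by
  rw [norm2, Matrix.l2_opNorm_def]
  refine ContinuousLinearMap.opNorm_le_bound _ zero_le_one fun x => ?_
  rw [one_mul]
  exact (hM.frob_mulVec x.ofLp).le

theorem frob_mul (hM : IsIsometric M) (G : c × s → 𝕜) :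
    frob (fun p : r × s => ∑ x, M p.1 x * G (x, p.2)) = frob G := by
  refine frob_eq_of_sq_eq (frob_nonneg G) ?_
  rw [frob_sq, Fintype.sum_prod_type_right, Fintype.sum_prod_type_right]
  refine Finset.sum_congr rfl fun b _ => ?_
  have h := congrArg (· ^ 2) (hM.frob_mulVec fun x => G (x, b))
  simp only [frob_sq] at h
  exact h

/-- Each column is the image of a unit vector, hence has norm 1. -/
theorem frob_eq (hM : IsIsometric M) :
    frob (fun p : r × c => M p.1 p.2) = √(Fintype.card c) := by
  refine frob_eq_of_sq_eq (by positivity) ?_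
  rw [Real.sq_sqrt (by positivity), Fintype.sum_prod_type_right]
  have (b : c) : ∑ a, ‖M a b‖ ^ 2 = 1 := by
    have h := hM.frob_mulVec (Pi.single b 1)
    rw [frob_single, norm_one] at h
    have h2 := frob_sq (M *ᵥ Pi.single b 1)
    rw [h] at h2
    simpa using h2.symm
  simp [this]

end IsIsometric

end Norm2

end Norms

/-! ### Splitting and gluing dependent tuples -/

section FinSplit

/-- Bond configurations of the two halves of a chain share the bond at the cut. They come from one
configuration as soon as they agree there, and this is what turns a contraction into a matrix
product. -/
theorem glue_overlap {k l : ℕ} {B : Fin (k + l + 1) → Type*}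
    (u : ∀ i : Fin (k + 1), B ⟨i.val, by omega⟩) (v : ∀ i : Fin (l + 1), B ⟨k + i.val, by omega⟩)
    (h : u (Fin.last k) = v 0) :
    ∃ b : ∀ i, B i, (∀ i : Fin (k + 1), b ⟨i.val, by omega⟩ = u i) ∧
      ∀ i : Fin (l + 1), b ⟨k + i.val, by omega⟩ = v i := by
  induction l with
  | zero =>
    refine ⟨u, fun i => rfl, fun i => ?_⟩
    obtain rfl : i = 0 := Fin.fin_one_eq_zero i
    exact h
  | succ l ih =>
    obtain ⟨b, hb₁, hb₂⟩ := ih (B := fun i => B i.castSucc) u (fun i => v i.castSucc) h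
    let last : B (Fin.last (k + (l + 1))) := v (Fin.last (l + 1))
    refine ⟨Fin.snoc (α := B) b last, fun i => ?_, fun i => ?_⟩
    · rw [← hb₁ i]
      exact Fin.snoc_castSucc (α := B) (i := ⟨i.val, by omega⟩) ..
    · induction i using Fin.lastCases with
      | last => exact Fin.snoc_last (α := B) ..
      | cast i =>
        rw [← hb₂ i]
        exact Fin.snoc_castSucc (α := B) (i := ⟨k + i.val, by omega⟩) ..

theorem split_bijective {k l n : ℕ} (h : k + l = n) (P : Fin n → Type*) :
    Function.Bijective fun p : ∀ i, P i =>
      ((fun i : Fin k => p ⟨i.val, by omega⟩ : ∀ i : Fin k, P ⟨i.val, by omega⟩),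
        (fun i : Fin l => p ⟨k + i.val, by omega⟩ : ∀ i : Fin l, P ⟨k + i.val, by omega⟩)) := by
  subst h
  constructor
  · intro p q hpq
    simp only [Prod.mk.injEq] at hpq
    funext i
    induction i using Fin.addCases with
    | left i => exact congrFun hpq.1 i
    | right i => exact congrFun hpq.2 i
  · rintro ⟨u, v⟩
    refine ⟨Fin.addCases (motive := P) u v, ?_⟩
    ext i
    · exact Fin.addCases_left (motive := P) i
    · exact Fin.addCases_right (motive := P) i

theorem prod_split {M : Type*} [CommMonoid M] {k l n : ℕ} (h : k + l = n) (f : Fin n → M) :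
    ∏ i, f i = (∏ i : Fin k, f ⟨i.val, by omega⟩) * ∏ i : Fin l, f ⟨k + i.val, by omega⟩ := by
  subst h
  exact Fin.prod_univ_add f

theorem snoc_bijective {n : ℕ} (P : Fin (n + 1) → Type*) :
    Function.Bijective fun p : ∀ i, P i => (Fin.init p, p (Fin.last n)) := by
  constructor
  · intro p q hpq
    simp only [Prod.mk.injEq] at hpq
    rw [← Fin.snoc_init_self p, ← Fin.snoc_init_self q, hpq.1, hpq.2]
  · rintro ⟨u, v⟩
    exact ⟨Fin.snoc u v, by simp⟩

theorem cons_bijective {n : ℕ} (P : Fin (n + 1) → Type*) :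
    Function.Bijective fun p : ∀ i, P i => (p 0, Fin.tail p) := by
  constructor
  · intro p q hpq
    simp only [Prod.mk.injEq] at hpq
    rw [← Fin.cons_self_tail p, ← Fin.cons_self_tail q, hpq.1, hpq.2]
  · rintro ⟨u, v⟩
    exact ⟨Fin.cons u v, by simp⟩

end FinSplit

/-! ### Contractions with an open end, one node at a time -/

namespace Chain

variable {𝕜 : Type*} [RCLike 𝕜]

section OpenContractions

variable {n : ℕ} {B : Fin (n + 1) → Type} {P : Fin n → Type}
  [∀ k, Fintype (B k)] [∀ k, DecidableEq (B k)]

/-- Contraction of a chain with its last bond left open. -/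
def openLast (A : Chain 𝕜 B P) : Matrix (∀ k, P k) (B (Fin.last n)) 𝕜 :=
  Matrix.of fun p y =>
    ∑ b : (∀ k, B k), if b (Fin.last n) = y then ∏ k, A k (b k.castSucc, p k, b k.succ) else 0

/-- Contraction of a chain with its first bond left open. -/
def openFirst (A : Chain 𝕜 B P) : Matrix (∀ k, P k) (B 0) 𝕜 :=
  Matrix.of fun p x =>
    ∑ b : (∀ k, B k), if b 0 = x then ∏ k, A k (b k.castSucc, p k, b k.succ) else 0

theorem contract_eq_sum_openLast (A : Chain 𝕜 B P) (p : ∀ k, P k) :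
    contract A p = ∑ y, openLast A p y := by
  simp only [openLast, contract, Matrix.of_apply]
  rw [Finset.sum_comm]
  simp

end OpenContractions

section Recursion

variable {n : ℕ} {B : Fin (n + 2) → Type} {P : Fin (n + 1) → Type}
  [∀ k, Fintype (B k)] [∀ k, DecidableEq (B k)]

theorem openLast_succ (A : Chain 𝕜 B P) (p : ∀ k, P k) (y : B (Fin.last (n + 1))) :
    openLast A p y = ∑ x,
      openLast (B := fun k => B k.castSucc) (P := fun k => P k.castSucc) (fun k => A k.castSucc)
        (Fin.init p) x * A (Fin.last n) (x, p (Fin.last n), y) := by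
  let g : (∀ k : Fin (n + 1), B k.castSucc) × B (Fin.last (n + 1)) → 𝕜 := fun q =>
    if q.2 = y then (∏ k : Fin n, A k.castSucc (q.1 k.castSucc, p k.castSucc, q.1 k.succ)) *
      A (Fin.last n) (q.1 (Fin.last n), p (Fin.last n), q.2) else 0
  calc openLast A p y = ∑ b, g (Fin.init b, b (Fin.last (n + 1))) := by
        simp only [openLast, Matrix.of_apply, Fin.prod_univ_castSucc]
        rfl
    _ = ∑ q, g q := (snoc_bijective B).sum_comp g
    _ = ∑ b : (∀ k : Fin (n + 1), B k.castSucc),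
          (∏ k : Fin n, A k.castSucc (b k.castSucc, p k.castSucc, b k.succ)) *
            A (Fin.last n) (b (Fin.last n), p (Fin.last n), y) := by
        simp [Fintype.sum_prod_type, g]
    _ = _ := by
        simp only [openLast, Matrix.of_apply, Finset.sum_mul]
        rw [Finset.sum_comm]
        simp [Fin.init]

theorem openFirst_succ (A : Chain 𝕜 B P) (p : ∀ k, P k) (x : B 0) :
    openFirst A p x = ∑ y, openFirst (B := fun k => B k.succ) (P := fun k => P k.succ)
      (fun k => A k.succ) (Fin.tail p) y * A 0 (x, p 0, y) := by
  let g : B 0 × (∀ k : Fin (n + 1), B k.succ) → 𝕜 := fun q =>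
    if q.1 = x then A 0 (q.1, p 0, q.2 0) *
      ∏ k : Fin n, A k.succ (q.2 k.castSucc, p k.succ, q.2 k.succ) else 0
  calc openFirst A p x = ∑ b, g (b 0, Fin.tail b) := by
        simp only [openFirst, Matrix.of_apply, Fin.prod_univ_succ]
        rfl
    _ = ∑ q, g q := (cons_bijective B).sum_comp g
    _ = ∑ b : (∀ k : Fin (n + 1), B k.succ), A 0 (x, p 0, b 0) *
          ∏ k : Fin n, A k.succ (b k.castSucc, p k.succ, b k.succ) := by
        simp [Fintype.sum_prod_type_right, g]
    _ = _ := by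
        simp only [openFirst, Matrix.of_apply, Finset.sum_mul]
        rw [Finset.sum_comm]
        refine Finset.sum_congr rfl fun b _ => ?_
        simp only [ite_mul, zero_mul, Finset.sum_ite_eq, Finset.mem_univ, if_true]
        exact mul_comm _ _

variable [∀ k, Fintype (P k)]

theorem frob_openLast_succ_le (A : Chain 𝕜 B P) :
    frob (fun q : (∀ k, P k) × B (Fin.last (n + 1)) => openLast A q.1 q.2) ≤
      norm2 (openLast (B := fun k => B k.castSucc) (P := fun k => P k.castSucc)
        fun k => A k.castSucc) * frob (A (Fin.last n)) := by
  let e : (∀ k, P k) × B (Fin.last (n + 1)) →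
      (∀ k : Fin n, P k.castSucc) × (P (Fin.last n) × B (Fin.last (n + 1))) :=
    fun q => (Fin.init q.1, q.1 (Fin.last n), q.2)
  have he : Function.Bijective e :=
    (Equiv.prodAssoc _ _ _).bijective.comp ((snoc_bijective P).prodMap Function.bijective_id)
  have h := frob_mul_le (openLast (B := fun k => B k.castSucc) (P := fun k => P k.castSucc)
        fun k => A k.castSucc) (A (Fin.last n))
  rw [← frob_comp he] at h
  simp only [openLast_succ]
  exact h

theorem frob_openFirst_succ_le (A : Chain 𝕜 B P) :
    frob (fun q : (∀ k, P k) × B 0 => openFirst A q.1 q.2) ≤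
      norm2 (openFirst (B := fun k => B k.succ) (P := fun k => P k.succ) fun k => A k.succ) *
        frob (A 0) := by
  let e : (∀ k, P k) × B 0 → (∀ k : Fin n, P k.succ) × (B 0 × P 0) :=
    fun q => (Fin.tail q.1, q.2, q.1 0)
  have he : Function.Bijective e :=
    ((Equiv.prodAssoc _ _ _).trans ((Equiv.prodComm _ _).trans
      (Equiv.prodAssoc _ _ _))).bijective.comp ((cons_bijective P).prodMap Function.bijective_id)
  let a : B (Fin.succ 0) × (B 0 × P 0) → 𝕜 := fun q => A 0 (q.2.1, q.2.2, q.1)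
  have ha : frob a = frob (A 0) :=
    frob_comp ((Equiv.prodComm _ _).trans (Equiv.prodAssoc _ _ _)).bijective (A 0)
  have h := frob_mul_le (openFirst (B := fun k => B k.succ) (P := fun k => P k.succ)
        fun k => A k.succ) a
  rw [← frob_comp he, ha] at h
  simp only [openFirst_succ]
  exact h

theorem frob_openLast_succ (A : Chain 𝕜 B P)
    (h : IsIsometric (openLast (B := fun k => B k.castSucc) (P := fun k => P k.castSucc)
        fun k => A k.castSucc)) :
    frob (fun q : (∀ k, P k) × B (Fin.last (n + 1)) => openLast A q.1 q.2) =
      frob (A (Fin.last n)) := by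
  let e : (∀ k, P k) × B (Fin.last (n + 1)) →
      (∀ k : Fin n, P k.castSucc) × (P (Fin.last n) × B (Fin.last (n + 1))) :=
    fun q => (Fin.init q.1, q.1 (Fin.last n), q.2)
  have he : Function.Bijective e :=
    (Equiv.prodAssoc _ _ _).bijective.comp ((snoc_bijective P).prodMap Function.bijective_id)
  have h := h.frob_mul (A (Fin.last n))
  rw [← frob_comp he] at h
  simp only [openLast_succ]
  exact h

/-- An isometry preserves inner products. The Gram matrix of the longer block is a sum over the new
physical leg of inner products of vectors `L *ᵥ a`, so `L` drops out and the Gram matrix of the new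
node is left. -/
theorem isIsometric_openLast_succ (A : Chain 𝕜 B P)
    (h : IsIsometric (openLast (B := fun k => B k.castSucc) (P := fun k => P k.castSucc)
        fun k => A k.castSucc)) (hA : IsIsometric (toRight A (Fin.last n))) :
    IsIsometric (openLast A) := by
  ext y y'
  let L := openLast (B := fun k => B k.castSucc) (P := fun k => P k.castSucc) fun k => A k.castSucc
  let a : P (Fin.last n) → B (Fin.last (n + 1)) → B (Fin.last n).castSucc → 𝕜 :=
    fun q y x => A (Fin.last n) (x, q, y)
  calc ((openLast A)ᴴ * openLast A) y y'
      = ∑ p : (∀ k, P k), star ((L *ᵥ a (p (Fin.last n)) y) (Fin.init p)) *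
          (L *ᵥ a (p (Fin.last n)) y') (Fin.init p) := by
        simp only [Matrix.mul_apply, Matrix.conjTranspose_apply, openLast_succ]
        rfl
    _ = ∑ q : (∀ k : Fin n, P k.castSucc) × P (Fin.last n),
          star ((L *ᵥ a q.2 y) q.1) * (L *ᵥ a q.2 y') q.1 :=
        (snoc_bijective P).sum_comp fun q : (∀ k : Fin n, P k.castSucc) × P (Fin.last n) =>
          star ((L *ᵥ a q.2 y) q.1) * (L *ᵥ a q.2 y') q.1
    _ = ∑ q, star (L *ᵥ a q y) ⬝ᵥ (L *ᵥ a q y') := by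
        rw [Fintype.sum_prod_type_right]
        rfl
    _ = ∑ q, star (a q y) ⬝ᵥ a q y' := by
        refine Finset.sum_congr rfl fun q _ => ?_
        have hL : Lᴴ * L = 1 := h
        rw [Matrix.star_mulVec, ← Matrix.dotProduct_mulVec, Matrix.mulVec_mulVec, hL,
          Matrix.one_mulVec]
    _ = ((toRight A (Fin.last n))ᴴ * toRight A (Fin.last n)) y y' := by
        simp only [Matrix.mul_apply, Matrix.conjTranspose_apply, Fintype.sum_prod_type_right]
        rfl
    _ = _ := by rw [hA]

end Recursion

section Blocks

theorem isIsometric_openLast {n : ℕ} {B : Fin (n + 1) → Type} {P : Fin n → Type}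
    [∀ k, Fintype (B k)] [∀ k, DecidableEq (B k)] [∀ k, Fintype (P k)] [Subsingleton (B 0)]
    (A : Chain 𝕜 B P) (hA : ∀ k, IsIsometric (toRight A k)) : IsIsometric (openLast A) := by
  induction n with
  | zero =>
    -- Without sites the block is the 1 × 1 identity, because the boundary bond has at most one
    -- index.
    ext y y'
    obtain rfl : y = y' := Subsingleton.elim (α := B 0) y y'
    have h (p : ∀ k, P k) (y : B 0) : openLast A p y = 1 := by
      have hb (b : ∀ k, B k) : b (Fin.last 0) = y := Subsingleton.elim (α := B 0) _ _
      let b : ∀ k, B k := fun k => (Fin.fin_one_eq_zero k).symm ▸ y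
      have hB (c : ∀ k, B k) : c = b := by
        funext k
        obtain rfl := Fin.fin_one_eq_zero k
        exact Subsingleton.elim (α := B 0) _ _
      simp only [openLast, Matrix.of_apply, hb, if_true]
      rw [Fintype.sum_eq_single b fun c hc => absurd (hB c) hc]
      simp
    simp only [Matrix.mul_apply, Matrix.conjTranspose_apply, Matrix.one_apply_eq]
    rw [Fintype.sum_unique]
    simp [h]
  | succ n ih =>
    refine isIsometric_openLast_succ A ?_ (hA _)
    have : Subsingleton (B (Fin.castSucc 0)) := inferInstanceAs (Subsingleton (B 0))
    exact ih (B := fun k => B k.castSucc) (P := fun k => P k.castSucc) _ fun k => hA k.castSucc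

theorem frob_openLast_le {n : ℕ} {B : Fin (n + 1) → Type} {P : Fin n → Type}
    [∀ k, Fintype (B k)] [∀ k, DecidableEq (B k)] [∀ k, Fintype (P k)] [Subsingleton (B 0)]
    (A : Chain 𝕜 B P) :
    frob (fun q : (∀ k, P k) × B (Fin.last n) => openLast A q.1 q.2) ≤ ∏ k, frob (A k) := by
  induction n with
  | zero =>
    have := (isIsometric_openLast A fun k => k.elim0).frob_eq
    rw [this]
    have hc : Fintype.card (B (Fin.last 0)) ≤ 1 :=
      Fintype.card_le_one_iff_subsingleton.2 (inferInstanceAs (Subsingleton (B 0)))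
    simpa using hc
  | succ n ih =>
    rw [Fin.prod_univ_castSucc]
    refine (frob_openLast_succ_le A).trans (mul_le_mul_of_nonneg_right ?_ (frob_nonneg _))
    have : Subsingleton (B (Fin.castSucc 0)) := inferInstanceAs (Subsingleton (B 0))
    exact (norm2_le_frob _).trans (ih (B := fun k => B k.castSucc) (P := fun k => P k.castSucc) _)

theorem frob_openFirst_le {n : ℕ} {B : Fin (n + 1) → Type} {P : Fin n → Type}
    [∀ k, Fintype (B k)] [∀ k, DecidableEq (B k)] [∀ k, Fintype (P k)]
    [Subsingleton (B (Fin.last n))] (A : Chain 𝕜 B P) :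
    frob (fun q : (∀ k, P k) × B 0 => openFirst A q.1 q.2) ≤ ∏ k, frob (A k) := by
  induction n with
  | zero =>
    have : Subsingleton (B 0) := inferInstanceAs (Subsingleton (B (Fin.last 0)))
    exact frob_openLast_le A
  | succ n ih =>
    rw [Fin.prod_univ_succ, mul_comm]
    refine (frob_openFirst_succ_le A).trans (mul_le_mul_of_nonneg_right ?_ (frob_nonneg _))
    have : Subsingleton (B (Fin.succ (Fin.last n))) :=
      inferInstanceAs (Subsingleton (B (Fin.last (n + 1))))
    exact (norm2_le_frob _).trans (ih (B := fun k => B k.succ) (P := fun k => P k.succ) _)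

end Blocks
end Chain

/-! ### Multilinear expansion and the perturbation bound for one chain -/

namespace Chain

variable {𝕜 : Type*} [RCLike 𝕜] {n : ℕ} {B : Fin (n + 1) → Type} {P : Fin n → Type}
  [∀ k, Fintype (B k)]

/-- Contraction of a chain, as a multilinear map of its nodes. -/
def contractMultilinear (𝕜 : Type*) [RCLike 𝕜] {n : ℕ} (B : Fin (n + 1) → Type)
    (P : Fin n → Type) [∀ k, Fintype (B k)] :
    MultilinearMap 𝕜 (fun k : Fin n => B k.castSucc × P k × B k.succ → 𝕜) ((∀ k, P k) → 𝕜) :=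
  MultilinearMap.pi fun p => ∑ b : (∀ k, B k),
    (MultilinearMap.mkPiAlgebra 𝕜 (Fin n) 𝕜).compLinearMap
      fun k => LinearMap.proj (b k.castSucc, p k, b k.succ)

theorem contractMultilinear_apply (A : Chain 𝕜 B P) :
    contractMultilinear 𝕜 B P A = contract A := by
  funext p
  simp [contractMultilinear, contract]

/-- A constant bounding the norm of a contraction by the product of the norms of the nodes. -/
noncomputable def contractBound {n : ℕ} (B : Fin (n + 1) → Type) (P : Fin n → Type) [∀ k, Fintype (B k)]
    [∀ k, Fintype (P k)] : ℝ :=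
  √(Fintype.card (∀ k, P k)) * Fintype.card (∀ k, B k)

theorem contractBound_nonneg [∀ k, Fintype (P k)] : 0 ≤ contractBound B P := by
  unfold contractBound
  positivity

/-- Every entry is a sum over bond configurations of products of node entries, each at most the norm
of its node. The bound is crude and serves only the terms of second order. -/
theorem frob_contract_le [∀ k, Fintype (P k)] (A : Chain 𝕜 B P) :
    frob (contract A) ≤ contractBound B P * ∏ k, frob (A k) := by
  rw [contractBound, mul_assoc]
  refine frob_le_of_forall_norm_le
    (mul_nonneg (Nat.cast_nonneg _) (Finset.prod_nonneg fun k _ => frob_nonneg _)) fun p => ?_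
  calc ‖contract A p‖ ≤ ∑ b : (∀ k, B k), ∏ k, ‖A k (b k.castSucc, p k, b k.succ)‖ := by
        refine (norm_sum_le _ _).trans_eq ?_
        simp only [norm_prod]
    _ ≤ ∑ _b : (∀ k, B k), ∏ k, frob (A k) :=
        Finset.sum_le_sum fun b _ => Finset.prod_le_prod (fun _ _ => norm_nonneg _)
          fun k _ => norm_apply_le_frob (A k) _
    _ = _ := by simp

variable [∀ k, DecidableEq (B k)]

theorem contract_eq_sum_blocks (A : Chain 𝕜 B P) (k : Fin (n + 1)) (p : ∀ i, P i) :
    contract A p = ∑ y, leftBlock A k (fun i => p (i.castLE (by omega))) y *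
      rightBlock A k (fun i => p ⟨k.val + i.val, by omega⟩) y := by
  let U := ∀ i : Fin (k.val + 1), B (i.castLE (by omega))
  let V := ∀ i : Fin (n - k.val + 1), B ⟨k.val + i.val, by omega⟩
  let f : U → 𝕜 := fun u =>
    ∏ i : Fin k.val, A (i.castLE (by omega)) (u i.castSucc, p (i.castLE (by omega)), u i.succ)
  let g : V → 𝕜 := fun v =>
    ∏ i : Fin (n - k.val), A ⟨k.val + i.val, by omega⟩
      (v i.castSucc, p ⟨k.val + i.val, by omega⟩, v i.succ)
  let ul : U → B k := fun u => u (Fin.last k.val)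
  let vf : V → B k := fun v => v 0
  let u : (∀ i, B i) → U := fun b i => b (i.castLE (by omega))
  let v : (∀ i, B i) → V := fun b i => b ⟨k.val + i.val, by omega⟩
  have hsplit (b : ∀ i, B i) :
      ∏ i, A i (b i.castSucc, p i, b i.succ) = f (u b) * g (v b) :=
    prod_split (k := k.val) (l := n - k.val) (by omega)
      fun i => A i (b i.castSucc, p i, b i.succ)
  calc contract A p = ∑ b, f (u b) * g (v b) := Finset.sum_congr rfl fun b _ => hsplit b
    _ = ∑ q : U × V with vf q.2 = ul q.1, f q.1 * g q.2 := by
        refine Finset.sum_bij (fun b _ => (u b, v b)) ?_ ?_ ?_ ?_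
        · intro b _
          rw [Finset.mem_filter]
          exact ⟨Finset.mem_univ _, rfl⟩
        · intro b _ c _ h
          simp only [Prod.mk.injEq] at h
          funext i
          rcases Nat.lt_or_ge i.val k.val with hi | hi
          · exact congrFun h.1 ⟨i.val, by omega⟩
          · have hj := congrFun h.2 ⟨i.val - k.val, by omega⟩
            -- The index equality holds only propositionally, so the dependent value has to be
            -- transported along it.
            have hik : (⟨k.val + (i.val - k.val), by omega⟩ : Fin (n + 1)) = i :=
              Fin.ext (by simp; omega)
            simp only [v] at hj
            rwa [hik] at hj
        · rintro ⟨u₀, v₀⟩ h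
          have h : vf v₀ = ul u₀ := (Finset.mem_filter.1 h).2
          -- Gluing happens over `Fin (k + (n - k) + 1)`; the result is read back on `Fin (n + 1)`
          -- through the underlying naturals.
          have hkn : k.val + (n - k.val) = n := by omega
          obtain ⟨b, hu, hv⟩ := glue_overlap (k := k.val) (l := n - k.val)
            (B := fun i => B ⟨i.val, by omega⟩) u₀ v₀ h.symm
          refine ⟨fun i => b ⟨i.val, by omega⟩, Finset.mem_univ _, ?_⟩
          refine Prod.ext (funext hu) (funext hv)
        · intro b _
          rfl
    _ = ∑ y, (∑ a, if ul a = y then f a else 0) * ∑ c, if vf c = y then g c else 0 := by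
        simp only [Finset.sum_mul_sum]
        rw [Finset.sum_comm, Finset.sum_filter, Fintype.sum_prod_type]
        refine Finset.sum_congr rfl fun a _ => ?_
        rw [Finset.sum_comm]
        refine Finset.sum_congr rfl fun c _ => ?_
        simp [eq_comm]
    _ = _ := rfl

/-- The environment of site `k` does not contain site `k`. Hence the environments in a first-order
term are those of the unperturbed chain. -/
theorem leftBlock_update (A : Chain 𝕜 B P) (k : Fin n) (E : B k.castSucc × P k × B k.succ → 𝕜) :
    leftBlock (Function.update A k E) k.castSucc = leftBlock A k.castSucc := by
  have h (i : Fin k.val) : (i.castLE (by omega) : Fin n) ≠ k := fun h => by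
    have := congrArg Fin.val h
    simp at this
    omega
  ext p y
  simp only [leftBlock, Matrix.of_apply]
  refine Finset.sum_congr rfl fun b _ => ?_
  congr 1
  refine Finset.prod_congr rfl fun i _ => ?_
  exact congrFun (Function.update_of_ne (h i) E A) _

theorem rightBlock_update (A : Chain 𝕜 B P) (k : Fin n)
    (E : B k.castSucc × P k × B k.succ → 𝕜) :
    rightBlock (Function.update A k E) k.succ = rightBlock A k.succ := by
  have h (i : Fin (n - k.succ.val)) : (⟨k.succ.val + i.val, by omega⟩ : Fin n) ≠ k := fun h => by
    have := congrArg Fin.val h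
    simp at this
    omega
  ext p y
  simp only [rightBlock, Matrix.of_apply]
  refine Finset.sum_congr rfl fun b _ => ?_
  congr 1
  refine Finset.prod_congr rfl fun i _ => ?_
  exact congrFun (Function.update_of_ne (h i) E A) _

variable [∀ k, Fintype (P k)]

theorem frob_contract_eq (A : Chain 𝕜 B P) (k : Fin (n + 1)) :
    frob (contract A) = frob fun q : (∀ i : Fin k.val, P (i.castLE (by omega))) ×
      (∀ i : Fin (n - k.val), P ⟨k.val + i.val, by omega⟩) =>
        ∑ y, leftBlock A k q.1 y * rightBlock A k q.2 y := by
  rw [← frob_comp (split_bijective (k := k.val) (l := n - k.val) (by omega) P)]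
  congr 1
  funext p
  exact contract_eq_sum_blocks A k p

theorem frob_contract_le_blocks (A : Chain 𝕜 B P) (k : Fin (n + 1)) :
    frob (contract A) ≤ frob (fun q : _ × B k => leftBlock A k q.1 q.2) *
      norm2 (rightBlock A k) := by
  have h := frob_mul_le (rightBlock A k) fun q => leftBlock A k q.2 q.1
  rw [← frob_comp (Equiv.prodComm _ _).bijective] at h
  rw [← frob_comp (Equiv.prodComm _ _).bijective fun q : B k × _ => leftBlock A k q.2 q.1] at h
  rw [frob_contract_eq A k, mul_comm]
  refine le_of_eq_of_le ?_ h
  congr 1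
  funext q
  exact Finset.sum_congr rfl fun y _ => mul_comm _ _

theorem frob_leftBlock_succ_le (A : Chain 𝕜 B P) (k : Fin n) :
    frob (fun q : _ × B k.succ => leftBlock A k.succ q.1 q.2) ≤
      norm2 (leftBlock A k.castSucc) * frob (A k) :=
  -- The left block at bond `k + 1` unfolds to the open contraction of the first `k + 1` sites.
  frob_openLast_succ_le (B := fun i : Fin (k.val + 2) => B (i.castLE (by omega)))
      (P := fun i : Fin (k.val + 1) => P (i.castLE (by omega))) fun i => A (i.castLE (by omega))

theorem frob_contract_le_envTerm (A : Chain 𝕜 B P) (k : Fin n) :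
    frob (contract A) ≤ envTerm A k :=
  (frob_contract_le_blocks A k.succ).trans
    (mul_le_mul_of_nonneg_right (frob_leftBlock_succ_le A k) (norm2_nonneg _))

theorem frob_contract_update_le (A : Chain 𝕜 B P) (k : Fin n)
    (E : B k.castSucc × P k × B k.succ → 𝕜) :
    frob (contract (Function.update A k E)) ≤
      norm2 (leftBlock A k.castSucc) * frob E * norm2 (rightBlock A k.succ) := by
  have h := frob_contract_le_envTerm (Function.update A k E) k
  rwa [envTerm, leftBlock_update, rightBlock_update, Function.update_self] at h

/-- The factor `M` is kept apart from `t` because the error of the contracted last column is only a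
constant multiple of the perturbation size, and that constant may exceed 1. -/
theorem frob_contract_add_sub_le (A E : Chain 𝕜 B P) {M t : ℝ} (hM : 1 ≤ M) (ht₀ : 0 ≤ t)
    (ht₁ : t ≤ 1) (hE : ∀ k, frob (E k) ≤ M * t * frob (A k)) :
    frob (contract (A + E) - contract A) ≤
      ∑ k, norm2 (leftBlock A k.castSucc) * frob (E k) * norm2 (rightBlock A k.succ) +
        contractBound B P * 2 ^ n * M ^ n * (∏ k, frob (A k)) * t ^ 2 := by
  have hdecomp : contract (A + E) - contract A = ∑ k, contract (Function.update A k (E k)) +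
      ∑ s : Finset (Fin n) with 2 ≤ s.card, contract (s.piecewise E A) := by
    have h := (contractMultilinear 𝕜 B P).map_add_eq_map_add_linearDeriv_add A E
    simp only [contractMultilinear_apply, MultilinearMap.linearDeriv_apply] at h
    have h' : contract (A + E) = _ := h
    rw [h', add_assoc, add_sub_cancel_left]
  have hprod : 0 ≤ ∏ k, frob (A k) := Finset.prod_nonneg fun k _ => frob_nonneg _
  have hhigh (s : Finset (Fin n)) (hs : 2 ≤ s.card) :
      frob (contract (s.piecewise E A)) ≤
        contractBound B P * (M ^ n * t ^ 2 * ∏ k, frob (A k)) := by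
    refine (frob_contract_le _).trans (mul_le_mul_of_nonneg_left ?_ contractBound_nonneg)
    calc ∏ k, frob (s.piecewise E A k) ≤ ∏ k, (if k ∈ s then M * t else 1) * frob (A k) := by
          refine Finset.prod_le_prod (fun _ _ => frob_nonneg _) fun k _ => ?_
          by_cases hk : k ∈ s
          · simpa [hk] using hE k
          · simp [hk]
      _ = (M * t) ^ s.card * ∏ k, frob (A k) := by
          rw [Finset.prod_mul_distrib]
          simp
      -- Since `M ≥ 1` and `t ≤ 1`, the bounds `2 ≤ |s| ≤ n` give `M ^ |s| ≤ M ^ n` and `t ^ |s| ≤ t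
      -- ^ 2`.
      _ ≤ _ := by
          refine mul_le_mul_of_nonneg_right ?_ hprod
          rw [mul_pow]
          refine mul_le_mul (pow_le_pow_right₀ hM (card_finset_fin_le s))
            (pow_le_pow_of_le_one ht₀ ht₁ hs) (by positivity) (by positivity)
  rw [hdecomp]
  refine (frob_add_le _ _).trans (add_le_add ?_ ?_)
  · exact (frob_sum_le _ _).trans
      (Finset.sum_le_sum fun k _ => frob_contract_update_le A k (E k))
  · refine (frob_sum_le _ _).trans ?_
    have hnn : 0 ≤ contractBound B P * (M ^ n * t ^ 2 * ∏ k, frob (A k)) :=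
      mul_nonneg contractBound_nonneg (by positivity)
    calc _ ≤ ∑ s : Finset (Fin n) with 2 ≤ s.card,
            contractBound B P * (M ^ n * t ^ 2 * ∏ k, frob (A k)) :=
          Finset.sum_le_sum fun s hs => hhigh s (Finset.mem_filter.1 hs).2
      -- Counting all subsets instead of those with at least two elements produces the factor `2 ^
      -- n`.
      _ ≤ ∑ _s : Finset (Fin n), contractBound B P * (M ^ n * t ^ 2 * ∏ k, frob (A k)) :=
          Finset.sum_le_sum_of_subset_of_nonneg (Finset.filter_subset _ _) fun _ _ _ => hnn
      _ = _ := by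
          simp only [Finset.sum_const, Finset.card_univ, Fintype.card_finset, Fintype.card_fin,
            nsmul_eq_mul, Nat.cast_pow, Nat.cast_ofNat]
          ring

end Chain

/-! ### Norms of environments; canonical chains -/

namespace Chain

variable {𝕜 : Type*} [RCLike 𝕜]

section Basic

variable {n : ℕ} {B : Fin (n + 1) → Type} {P : Fin n → Type} [∀ k, Fintype (B k)]

theorem node_ne_zero_of_contract_ne_zero {A : Chain 𝕜 B P} (h : contract A ≠ 0) (k : Fin n) :
    A k ≠ 0 := by
  contrapose! h
  funext p
  refine Finset.sum_eq_zero fun b _ => Finset.prod_eq_zero (Finset.mem_univ k) ?_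
  rw [h]
  rfl

variable [∀ k, DecidableEq (B k)] [∀ k, Fintype (P k)]

theorem norm2_leftBlock_le_prod [Subsingleton (B 0)] (A : Chain 𝕜 B P) (k : Fin (n + 1)) :
    norm2 (leftBlock A k) ≤ ∏ i : Fin k.val, frob (A (i.castLE (by omega))) := by
  have h₁ : k.val + 1 ≤ n + 1 := by omega
  have h₂ : k.val ≤ n := by omega
  have : Subsingleton (B (Fin.castLE h₁ (0 : Fin (k.val + 1)))) :=
    inferInstanceAs (Subsingleton (B 0))
  exact (norm2_le_frob _).trans (frob_openLast_le
    (B := fun i : Fin (k.val + 1) => B (i.castLE h₁))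
    (P := fun i : Fin k.val => P (i.castLE h₂)) fun i => A (i.castLE h₂))

theorem norm2_rightBlock_le_prod [Subsingleton (B (Fin.last n))] (A : Chain 𝕜 B P)
    (k : Fin (n + 1)) :
    norm2 (rightBlock A k) ≤ ∏ i : Fin (n - k.val), frob (A ⟨k.val + i.val, by omega⟩) := by
  let B' : Fin (n - k.val + 1) → Type := fun i => B ⟨k.val + i.val, by omega⟩
  have hs : Subsingleton (B' (Fin.last _)) := by
    have h : (⟨k.val + (Fin.last (n - k.val)).val, by simp; omega⟩ : Fin (n + 1)) =
      Fin.last n := Fin.ext (by simp; omega)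
    change Subsingleton (B _)
    rw [h]
    infer_instance
  exact (norm2_le_frob _).trans (frob_openFirst_le (B := B')
    (P := fun i : Fin (n - k.val) => P ⟨k.val + i.val, by omega⟩)
    fun i => A ⟨k.val + i.val, by omega⟩)

theorem norm2_rightBlock_last_le [Subsingleton (B (Fin.last n))] (A : Chain 𝕜 B P) :
    norm2 (rightBlock A (Fin.last n)) ≤ 1 := by
  have he : IsEmpty (Fin (n - (Fin.last n).val)) := by
    rw [Fin.val_last, Nat.sub_self]
    infer_instance
  have h := norm2_rightBlock_le_prod A (Fin.last n)
  rwa [Finset.univ_eq_empty, Finset.prod_empty] at h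

theorem envTerm_le_one [Subsingleton (B 0)] [Subsingleton (B (Fin.last n))] {A : Chain 𝕜 B P}
    (hA : ∀ k, frob (A k) ≤ 1) (k : Fin n) : envTerm A k ≤ 1 := by
  have h₁ : norm2 (leftBlock A k.castSucc) ≤ 1 := (norm2_leftBlock_le_prod A _).trans
    (Finset.prod_le_one (fun _ _ => frob_nonneg _) fun i _ => hA _)
  have h₂ : norm2 (rightBlock A k.succ) ≤ 1 := (norm2_rightBlock_le_prod A _).trans
    (Finset.prod_le_one (fun _ _ => frob_nonneg _) fun i _ => hA _)
  exact mul_le_one₀ (mul_le_one₀ h₁ (frob_nonneg _) (hA k)) (norm2_nonneg _) h₂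

end Basic

section Canonical

variable {n : ℕ} {B : Fin (n + 2) → Type} {P : Fin (n + 1) → Type}
  [∀ k, Fintype (B k)] [∀ k, DecidableEq (B k)] [∀ k, Fintype (P k)]

theorem frob_node_of_isIsometric {A : Chain 𝕜 B P} {k : Fin (n + 1)}
    (hA : IsIsometric (toRight A k)) : frob (A k) = √(Fintype.card (B k.succ)) := by
  rw [← hA.frob_eq, ← frob_comp (Equiv.prodAssoc _ _ _).bijective]
  rfl

variable {A : Chain 𝕜 B P} (hA : ∀ i : Fin n, IsIsometric (toRight A i.castSucc))
include hA

theorem isIsometric_leftBlock [Subsingleton (B 0)] (k : Fin (n + 1)) :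
    IsIsometric (leftBlock A k.castSucc) := by
  have h₁ : k.val + 1 ≤ n + 2 := by omega
  have h₂ : k.val ≤ n + 1 := by omega
  have : Subsingleton (B (Fin.castLE h₁ (0 : Fin (k.val + 1)))) :=
    inferInstanceAs (Subsingleton (B 0))
  exact isIsometric_openLast (B := fun i : Fin (k.val + 1) => B (i.castLE h₁))
    (P := fun i : Fin k.val => P (i.castLE h₂)) (fun i => A (i.castLE h₂))
    fun i => hA ⟨i.val, by omega⟩

/-- The block before the last node is an isometry and the final bond is trivial, so the center
carries the whole norm. -/
theorem frob_contract_eq_last [Subsingleton (B 0)] [Unique (B (Fin.last (n + 1)))] :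
    frob (contract A) = frob (A (Fin.last n)) := by
  rw [← frob_openLast_succ A (isIsometric_leftBlock hA (Fin.last n)),
    ← frob_comp (Equiv.prodUnique (∀ k, P k) (B (Fin.last (n + 1)))).bijective]
  congr 1
  funext q
  refine (contract_eq_sum_openLast A q.1).trans ?_
  rw [Fintype.sum_unique, Subsingleton.elim default q.2]

/-- The contraction is `L Rᵀ` with `L` an isometry, so its Frobenius norm is that of `R`, which
dominates the spectral norm. -/
theorem norm2_rightBlock_le [Subsingleton (B 0)] (k : Fin (n + 1)) :
    norm2 (rightBlock A k.castSucc) ≤ frob (contract A) := by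
  have h := (isIsometric_leftBlock hA k).frob_mul
    fun q : B k.castSucc × _ => rightBlock A k.castSucc q.2 q.1
  rw [frob_contract_eq A k.castSucc]
  refine (norm2_le_frob _).trans (le_of_eq (Eq.trans ?_ h.symm))
  exact (frob_comp (Equiv.prodComm _ _).bijective _).symm

end Canonical

end Chain

/-! ### Boundary bonds of the grid and contracted columns -/

namespace Shape

variable {m n : ℕ} (S : Shape m n)

instance uniqueColBondZero : Unique (S.ColBond 0) :=
  haveI (i : Fin (m + 1)) : Unique (Fin (S.hor i 0)) := by
    rw [S.hor_first]; infer_instance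
  Pi.unique

instance uniqueColBondLast : Unique (S.ColBond (Fin.last (n + 1))) :=
  haveI (i : Fin (m + 1)) : Unique (Fin (S.hor i (Fin.last (n + 1)))) := by
    rw [S.hor_last]; infer_instance
  Pi.unique

instance uniqueVerBondZero (j : Fin (n + 1)) : Unique (S.VerBond j 0) := by
  unfold VerBond
  rw [S.ver_first]; infer_instance

instance uniqueVerBondLast (j : Fin (n + 1)) : Unique (S.VerBond j (Fin.last (m + 1))) := by
  unfold VerBond
  rw [S.ver_last]; infer_instance

theorem rowLegs_bijective (j : Fin (n + 1)) :
    Function.Bijective fun x : S.ColBond j.castSucc × S.ColPhys j × S.ColBond j.succ =>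
      (fun i => (x.1 i, x.2.1 i, x.2.2 i) : ∀ i, S.RowLegs j i) := by
  constructor
  · rintro ⟨a, b, c⟩ ⟨a', b', c'⟩ h
    simp only [funext_iff, Prod.mk.injEq] at h ⊢
    exact ⟨fun i => (h i).1, fun i => (h i).2.1, fun i => (h i).2.2⟩
  · intro q
    exact ⟨(fun i => (q i).1, fun i => (q i).2.1, fun i => (q i).2.2), rfl⟩

end Shape

variable {𝕜 : Type*} [RCLike 𝕜] {m n : ℕ} {S : Shape m n}

theorem frob_colTensor {j : Fin (n + 1)} (t : S.Column 𝕜 j) :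
    frob (colTensor t) = frob (Chain.contract t) :=
  frob_comp (S.rowLegs_bijective j) (Chain.contract t)

theorem frob_colTensor_sub {j : Fin (n + 1)} (t t' : S.Column 𝕜 j) :
    frob (colTensor t - colTensor t') = frob (Chain.contract t - Chain.contract t') :=
  frob_comp (S.rowLegs_bijective j) (Chain.contract t - Chain.contract t')

/-! ### Error bounds for the last column and for the whole PEPS -/

namespace PEPS

theorem frob_contract_last_pos {T : S.PEPS 𝕜} (hT : tensor T ≠ 0) :
    0 < frob (Chain.contract (T (Fin.last n))) := by
  rw [← frob_colTensor]
  exact frob_pos (Chain.node_ne_zero_of_contract_ne_zero hT (Fin.last n))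

/-- Constant of the second-order term for the last column. -/
noncomputable def lastConst (S : Shape m n) (b : ℝ) : ℝ :=
  Chain.contractBound (S.VerBond (Fin.last n)) (S.RowLegs (Fin.last n)) * 2 ^ (m + 1) * b

/-- Constant of the second-order term for the whole PEPS. -/
noncomputable def wholeConst (S : Shape m n) (U a b : ℝ) : ℝ :=
  Chain.contractBound S.ColBond S.ColPhys * 2 ^ (n + 1) *
    max 1 (U + lastConst S b) ^ (n + 1) * a

theorem lastConst_nonneg (S : Shape m n) {b : ℝ} (hb : 0 ≤ b) : 0 ≤ lastConst S b := by
  have := Chain.contractBound_nonneg (B := S.VerBond (Fin.last n)) (P := S.RowLegs (Fin.last n))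
  unfold lastConst
  positivity

theorem wholeConst_nonneg (S : Shape m n) (U b : ℝ) {a : ℝ} (ha : 0 ≤ a) :
    0 ≤ wholeConst S U a b := by
  have := Chain.contractBound_nonneg (B := S.ColBond) (P := S.ColPhys)
  unfold wholeConst
  positivity

theorem errLast_le {T : S.PEPS 𝕜} (hT : tensor T ≠ 0) {b : ℝ}
    (hb : ∏ i, frob (T (Fin.last n) i) ≤ b * frob (Chain.contract (T (Fin.last n))))
    {ε₁ ε₂ : ℝ} (hε₀ : 0 ≤ ε₂) (hε₁ : ε₂ ≤ 1)
    {Δ : ∀ j : Fin n, S.ColTensor 𝕜 j.castSucc} {δ : S.Column 𝕜 (Fin.last n)}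
    (h : IsPerturbation T ε₁ ε₂ Δ δ) :
    errLast T δ ≤ ε₂ * lastCoeff T + lastConst S b * ε₂ ^ 2 := by
  have hpos := frob_contract_last_pos hT
  have hmain := Chain.frob_contract_add_sub_le (T (Fin.last n)) δ le_rfl hε₀ hε₁
    (by simpa using h.2)
  have hc := Chain.contractBound_nonneg (B := S.VerBond (Fin.last n))
    (P := S.RowLegs (Fin.last n))
  rw [errLast, relErr, div_le_iff₀ hpos]
  refine hmain.trans ?_
  rw [add_mul]
  refine add_le_add ?_ ?_
  · rw [lastCoeff, mul_assoc, Finset.sum_mul, Finset.mul_sum]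
    refine Finset.sum_le_sum fun i _ => ?_
    rw [div_mul_cancel₀ _ hpos.ne', Chain.envTerm]
    calc _ ≤ norm2 (Chain.leftBlock (T (Fin.last n)) i.castSucc) *
          (ε₂ * frob (T (Fin.last n) i)) * norm2 (Chain.rightBlock (T (Fin.last n)) i.succ) := by
          refine mul_le_mul_of_nonneg_right ?_ (norm2_nonneg _)
          exact mul_le_mul_of_nonneg_left (h.2 i) (norm2_nonneg _)
      _ = _ := by ring
  · rw [one_pow, mul_one, lastConst]
    calc _ ≤ Chain.contractBound (S.VerBond (Fin.last n)) (S.RowLegs (Fin.last n)) *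
          2 ^ (m + 1) * (b * frob (Chain.contract (T (Fin.last n)))) * ε₂ ^ 2 := by gcongr
      _ = _ := by ring

theorem perturbedColumns_eq (T : S.PEPS 𝕜) (Δ : ∀ j : Fin n, S.ColTensor 𝕜 j.castSucc)
    (δ : S.Column 𝕜 (Fin.last n)) :
    perturbedColumns T Δ δ = columns T + Fin.lastCases
      (motive := fun j => S.ColTensor 𝕜 j)
      (colTensor (T (Fin.last n) + δ) - colTensor (T (Fin.last n))) Δ := by
  funext j
  induction j using Fin.lastCases with
  | last => simp [perturbedColumns, columns]
  | cast j => simp [perturbedColumns, columns]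

/-- The parameters `U`, `a`, `b` carry all dependence of the constant on `T`, so the same estimate
yields a constant for each PEPS and a uniform one for canonical PEPS. -/
theorem err_le {T : S.PEPS 𝕜} (hT : tensor T ≠ 0) {U a b : ℝ} (hU : lastCoeff T ≤ U)
    (ha : ∏ j, frob (columns T j) ≤ a * frob (tensor T)) (hb₀ : 0 ≤ b)
    (hb : ∏ i, frob (T (Fin.last n) i) ≤ b * frob (Chain.contract (T (Fin.last n))))
    {ε₁ ε₂ : ℝ} (hε₁ : ε₁ ∈ Set.Icc (0 : ℝ) 1) (hε₂ : ε₂ ∈ Set.Icc (0 : ℝ) 1)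
    {Δ : ∀ j : Fin n, S.ColTensor 𝕜 j.castSucc} {δ : S.Column 𝕜 (Fin.last n)}
    (h : IsPerturbation T ε₁ ε₂ Δ δ) :
    err T Δ δ ≤ ε₁ * colCoeff T + errLast T δ * lastFactor T +
      wholeConst S U a b * (ε₁ ^ 2 + ε₂ ^ 2) := by
  have hpos : 0 < frob (tensor T) := frob_pos hT
  have hpos' := frob_contract_last_pos hT
  have hc := Chain.contractBound_nonneg (B := S.ColBond) (P := S.ColPhys)
  have hL := lastConst_nonneg S hb₀
  have hΔ (j : Fin n) : frob (Δ j) ≤ ε₁ * frob (columns T j.castSucc) := h.1 j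
  set M : ℝ := max 1 (U + lastConst S b) with hM
  have hM₁ : 1 ≤ M := le_max_left _ _
  set t : ℝ := max ε₁ ε₂ with ht
  have ht₀ : 0 ≤ t := hε₁.1.trans (le_max_left _ _)
  have ht₁ : t ≤ 1 := max_le hε₁.2 hε₂.2
  have ht₂ : t ^ 2 ≤ ε₁ ^ 2 + ε₂ ^ 2 := by
    rcases max_choice ε₁ ε₂ with h' | h' <;> rw [ht, h'] <;> nlinarith [sq_nonneg ε₁, sq_nonneg ε₂]
  have hlast : frob (colTensor (T (Fin.last n) + δ) - colTensor (T (Fin.last n))) =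
      errLast T δ * frob (columns T (Fin.last n)) := by
    rw [frob_colTensor_sub, columns, frob_colTensor, errLast, relErr, div_mul_cancel₀ _ hpos'.ne']
  -- Since `ε₂ ^ 2 ≤ ε₂`, the estimate for the last column is linear in `ε₂`; this is the origin of
  -- `M`.
  have herr : errLast T δ ≤ M * t := by
    refine (errLast_le hT hb hε₂.1 hε₂.2 h).trans ?_
    have h1 : ε₂ ^ 2 ≤ ε₂ := by nlinarith [hε₂.1, hε₂.2]
    calc _ ≤ ε₂ * U + lastConst S b * ε₂ := by
          refine add_le_add (mul_le_mul_of_nonneg_left hU hε₂.1) (mul_le_mul_of_nonneg_left h1 hL)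
      _ = (U + lastConst S b) * ε₂ := by ring
      _ ≤ M * t := mul_le_mul (le_max_right _ _) (le_max_right _ _) hε₂.1 (by positivity)
  have hmain := Chain.frob_contract_add_sub_le (columns T) (Fin.lastCases
      (motive := fun j => S.ColTensor 𝕜 j)
      (colTensor (T (Fin.last n) + δ) - colTensor (T (Fin.last n))) Δ) hM₁ ht₀ ht₁ (by
    intro j
    induction j using Fin.lastCases with
    | last =>
      rw [Fin.lastCases_last, hlast]
      exact mul_le_mul_of_nonneg_right herr (frob_nonneg _)
    | cast j =>
      rw [Fin.lastCases_castSucc]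
      refine (hΔ j).trans (mul_le_mul_of_nonneg_right ?_ (frob_nonneg _))
      calc ε₁ ≤ t := le_max_left _ _
        _ ≤ M * t := le_mul_of_one_le_left ht₀ hM₁)
  rw [err, perturbedColumns_eq, relErr, div_le_iff₀ hpos]
  refine hmain.trans ?_
  rw [add_mul]
  refine add_le_add ?_ ?_
  · rw [Fin.sum_univ_castSucc, add_mul]
    refine add_le_add ?_ ?_
    · rw [colCoeff, mul_assoc, Finset.sum_mul, Finset.mul_sum]
      refine Finset.sum_le_sum fun j _ => ?_
      rw [div_mul_cancel₀ _ hpos.ne', Chain.envTerm, Fin.lastCases_castSucc]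
      calc _ ≤ norm2 (Chain.leftBlock (columns T) j.castSucc.castSucc) *
            (ε₁ * frob (columns T j.castSucc)) *
              norm2 (Chain.rightBlock (columns T) j.castSucc.succ) := by
            refine mul_le_mul_of_nonneg_right ?_ (norm2_nonneg _)
            exact mul_le_mul_of_nonneg_left (hΔ j) (norm2_nonneg _)
        _ = _ := by ring
    · rw [Fin.lastCases_last, hlast, lastFactor, mul_assoc (errLast T δ),
        div_mul_cancel₀ _ hpos.ne']
      -- Nothing lies to the right of the last column, which is why `lastFactor` has no right
      -- environment.
      have hR : norm2 (Chain.rightBlock (columns T) (Fin.last n).succ) ≤ 1 :=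
        Chain.norm2_rightBlock_last_le (columns T)
      have hnn : 0 ≤ norm2 (Chain.leftBlock (columns T) (Fin.last n).castSucc) *
          (errLast T δ * frob (columns T (Fin.last n))) :=
        mul_nonneg (norm2_nonneg _) (mul_nonneg (relErr_nonneg _ _) (frob_nonneg _))
      refine (mul_le_of_le_one_right hnn hR).trans_eq ?_
      rw [columns]
      ring
  · rw [wholeConst]
    calc _ ≤ Chain.contractBound S.ColBond S.ColPhys * 2 ^ (n + 1) * M ^ (n + 1) *
          (a * frob (tensor T)) * (ε₁ ^ 2 + ε₂ ^ 2) := by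
          have h0 : 0 ≤ ∏ j, frob (columns T j) := Finset.prod_nonneg fun _ _ => frob_nonneg _
          refine mul_le_mul ?_ ht₂ (by positivity) ?_
          · exact mul_le_mul_of_nonneg_left ha (by positivity)
          · exact mul_nonneg (by positivity) (h0.trans ha)
      _ = _ := by ring

end PEPS

theorem sqrt_card_colBond (S : Shape m n) (k : Fin (n + 2)) :
    √(Fintype.card (S.ColBond k) : ℝ) = ∏ i, √(S.hor i k : ℝ) := by
  rw [← Real.sqrt_prod _ fun _ _ => Nat.cast_nonneg _]
  simp

/-- There are `m + 1` rows, hence the exponent `(m + 1) / 2`. -/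
theorem sqrt_pow_eq_rpow (D : ℕ) (m : ℕ) : √(D : ℝ) ^ (m + 1) = (D : ℝ) ^ ((m + 1 : ℝ) / 2) := by
  rw [Real.sqrt_eq_rpow, ← Real.rpow_natCast, ← Real.rpow_mul (Nat.cast_nonneg _)]
  congr 1
  push_cast
  ring

/-! ### Coefficients in canonical form and uniform constants -/

namespace PEPS

namespace IsCanonical

variable {C : S.PEPS 𝕜} (hC : IsCanonical C)
include hC

theorem frob_column (j : Fin n) :
    frob (columns C j.castSucc) = ∏ i, √(S.hor i j.castSucc.succ : ℝ) := by
  rw [Chain.frob_node_of_isIsometric (hC.1 j), sqrt_card_colBond]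

theorem frob_node (i : Fin m) :
    frob (C (Fin.last n) i.castSucc) = √(S.ver i.castSucc.succ (Fin.last n) : ℝ) := by
  rw [Chain.frob_node_of_isIsometric (hC.2 i), Fintype.card_fin]

theorem frob_tensor : frob (tensor C) = frob (columns C (Fin.last n)) :=
  Chain.frob_contract_eq_last hC.1

theorem frob_contract_last :
    frob (Chain.contract (C (Fin.last n))) = frob (C (Fin.last n) (Fin.last m)) :=
  Chain.frob_contract_eq_last hC.2

theorem colCoeff_le : colCoeff C ≤ canonColCoeff C := by
  rw [colCoeff, canonColCoeff]
  refine Finset.sum_le_sum fun j _ => div_le_div_of_nonneg_right ?_ (frob_nonneg _)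
  rw [Chain.envTerm, ← hC.frob_column]
  refine mul_le_mul_of_nonneg_right ?_ (norm2_nonneg _)
  exact mul_le_of_le_one_left (frob_nonneg _)
    (Chain.isIsometric_leftBlock hC.1 j.castSucc).norm2_le_one

theorem lastFactor_le_one : lastFactor C ≤ 1 := by
  rw [lastFactor, hC.frob_tensor]
  refine div_le_one_of_le₀ ?_ (frob_nonneg _)
  exact mul_le_of_le_one_left (frob_nonneg _)
    (Chain.isIsometric_leftBlock hC.1 (Fin.last n)).norm2_le_one

theorem lastCoeff_le : lastCoeff C ≤ canonLastCoeff C := by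
  rw [lastCoeff, canonLastCoeff, Fin.sum_univ_castSucc, add_comm]
  refine add_le_add ?_ (Finset.sum_le_sum fun i _ => ?_)
  · rw [hC.frob_contract_last, Chain.envTerm]
    refine div_le_one_of_le₀ ?_ (frob_nonneg _)
    refine (mul_le_of_le_one_right (mul_nonneg (norm2_nonneg _) (frob_nonneg _))
      (Chain.norm2_rightBlock_last_le _)).trans ?_
    exact mul_le_of_le_one_left (frob_nonneg _)
      (Chain.isIsometric_leftBlock hC.2 (Fin.last m)).norm2_le_one
  · refine div_le_div_of_nonneg_right ?_ (frob_nonneg _)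
    rw [Chain.envTerm, ← hC.frob_node]
    refine mul_le_mul_of_nonneg_right ?_ (norm2_nonneg _)
    exact mul_le_of_le_one_left (frob_nonneg _)
      (Chain.isIsometric_leftBlock hC.2 i.castSucc).norm2_le_one

theorem canonColCoeff_le {D : ℕ}
    (hD : ∀ (i : Fin (m + 1)) (j : Fin n), S.hor i j.castSucc.succ ≤ D) :
    canonColCoeff C ≤ n * (D : ℝ) ^ ((m + 1 : ℝ) / 2) := by
  rw [canonColCoeff, ← sqrt_pow_eq_rpow]
  calc _ ≤ ∑ _j : Fin n, √(D : ℝ) ^ (m + 1) := by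
        refine Finset.sum_le_sum fun j _ => ?_
        refine div_le_of_le_mul₀ (frob_nonneg _) (by positivity) ?_
        refine mul_le_mul ?_ (Chain.norm2_rightBlock_le hC.1 j.succ) (norm2_nonneg _)
          (by positivity)
        calc _ ≤ ∏ _i : Fin (m + 1), √(D : ℝ) :=
              Finset.prod_le_prod (fun _ _ => Real.sqrt_nonneg _) fun i _ =>
                Real.sqrt_le_sqrt (Nat.cast_le.2 (hD i j))
          _ = _ := by simp
    _ = _ := by simp

theorem canonLastCoeff_le {D : ℕ} (hD : ∀ i : Fin m, S.ver i.castSucc.succ (Fin.last n) ≤ D) :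
    canonLastCoeff C ≤ 1 + m * √(D : ℝ) := by
  rw [canonLastCoeff]
  refine add_le_add le_rfl ?_
  calc _ ≤ ∑ _i : Fin m, √(D : ℝ) := by
        refine Finset.sum_le_sum fun i _ => ?_
        refine div_le_of_le_mul₀ (frob_nonneg _) (Real.sqrt_nonneg _) ?_
        exact mul_le_mul (Real.sqrt_le_sqrt (Nat.cast_le.2 (hD i)))
          (Chain.norm2_rightBlock_le hC.2 i.succ) (norm2_nonneg _) (Real.sqrt_nonneg _)
    _ = _ := by simp

theorem prod_frob_columns :
    ∏ j, frob (columns C j) =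
      (∏ j : Fin n, ∏ i, √(S.hor i j.castSucc.succ : ℝ)) * frob (tensor C) := by
  rw [Fin.prod_univ_castSucc, hC.frob_tensor]
  simp only [hC.frob_column]

theorem prod_frob_nodes :
    ∏ i, frob (C (Fin.last n) i) = (∏ i : Fin m, √(S.ver i.castSucc.succ (Fin.last n) : ℝ)) *
      frob (Chain.contract (C (Fin.last n))) := by
  rw [Fin.prod_univ_castSucc, hC.frob_contract_last]
  simp only [hC.frob_node]

end IsCanonical

theorem exists_general_bound (T : S.PEPS 𝕜) (hT : tensor T ≠ 0) :
    ∃ K : ℝ, 0 ≤ K ∧ ∀ ε₁ ∈ Set.Icc (0 : ℝ) 1, ∀ ε₂ ∈ Set.Icc (0 : ℝ) 1,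
      ∀ (Δ : ∀ j : Fin n, S.ColTensor 𝕜 j.castSucc) (δ : S.Column 𝕜 (Fin.last n)),
        IsPerturbation T ε₁ ε₂ Δ δ →
          err T Δ δ ≤ ε₁ * colCoeff T + errLast T δ * lastFactor T + K * (ε₁ ^ 2 + ε₂ ^ 2) ∧
          errLast T δ ≤ ε₂ * lastCoeff T + K * ε₂ ^ 2 := by
  have hpos : 0 < frob (tensor T) := frob_pos hT
  have hpos' := frob_contract_last_pos hT
  have hprod : 0 ≤ ∏ j, frob (columns T j) := Finset.prod_nonneg fun _ _ => frob_nonneg _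
  have hprod' : 0 ≤ ∏ i, frob (T (Fin.last n) i) := Finset.prod_nonneg fun _ _ => frob_nonneg _
  set a : ℝ := (∏ j, frob (columns T j)) / frob (tensor T)
  set b : ℝ := (∏ i, frob (T (Fin.last n) i)) / frob (Chain.contract (T (Fin.last n)))
  have ha₀ : 0 ≤ a := div_nonneg hprod hpos.le
  have hb₀ : 0 ≤ b := div_nonneg hprod' hpos'.le
  have ha : ∏ j, frob (columns T j) ≤ a * frob (tensor T) := (div_mul_cancel₀ _ hpos.ne').ge
  have hb : ∏ i, frob (T (Fin.last n) i) ≤ b * frob (Chain.contract (T (Fin.last n))) :=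
    (div_mul_cancel₀ _ hpos'.ne').ge
  have h₁ := wholeConst_nonneg S (lastCoeff T) b ha₀
  have h₂ := lastConst_nonneg S hb₀
  refine ⟨wholeConst S (lastCoeff T) a b + lastConst S b, by positivity,
    fun ε₁ hε₁ ε₂ hε₂ Δ δ h => ⟨?_, ?_⟩⟩
  · refine (err_le hT le_rfl ha hb₀ hb hε₁ hε₂ h).trans ?_
    gcongr
    linarith
  · refine (errLast_le hT hb hε₂.1 hε₂.2 h).trans ?_
    gcongr
    linarith

theorem exists_canonical_bound (𝕜 : Type*) [RCLike 𝕜] (S : Shape m n) (D : ℕ)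
    (hrow : ∀ i : Fin m, S.ver i.castSucc.succ (Fin.last n) ≤ D) :
    ∃ K : ℝ, 0 ≤ K ∧ ∀ C : S.PEPS 𝕜, tensor C ≠ 0 → IsCanonical C →
      ∀ ε₁ ∈ Set.Icc (0 : ℝ) 1, ∀ ε₂ ∈ Set.Icc (0 : ℝ) 1,
        ∀ (Δ : ∀ j : Fin n, S.ColTensor 𝕜 j.castSucc) (δ : S.Column 𝕜 (Fin.last n)),
          IsPerturbation C ε₁ ε₂ Δ δ →
            err C Δ δ ≤ ε₁ * canonColCoeff C + errLast C δ + K * (ε₁ ^ 2 + ε₂ ^ 2) ∧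
            errLast C δ ≤ ε₂ * canonLastCoeff C + K * ε₂ ^ 2 := by
  -- By `prod_frob_columns` and `prod_frob_nodes` these are exact ratios for every canonical PEPS,
  -- so the constant can be chosen before `C`.
  set a : ℝ := ∏ j : Fin n, ∏ i, √(S.hor i j.castSucc.succ : ℝ)
  set b : ℝ := ∏ i : Fin m, √(S.ver i.castSucc.succ (Fin.last n) : ℝ)
  have ha₀ : 0 ≤ a := by positivity
  have hb₀ : 0 ≤ b := by positivity
  have h₁ := wholeConst_nonneg S (1 + m * √(D : ℝ)) b ha₀
  have h₂ := lastConst_nonneg S hb₀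
  refine ⟨wholeConst S (1 + m * √(D : ℝ)) a b + lastConst S b, by positivity,
    fun C hne hC ε₁ hε₁ ε₂ hε₂ Δ δ h => ⟨?_, ?_⟩⟩
  · refine (err_le hne (hC.lastCoeff_le.trans (hC.canonLastCoeff_le hrow)) hC.prod_frob_columns.le
      hb₀ hC.prod_frob_nodes.le hε₁ hε₂ h).trans ?_
    refine add_le_add (add_le_add (mul_le_mul_of_nonneg_left hC.colCoeff_le hε₁.1)
      (mul_le_of_le_one_right (relErr_nonneg _ _) hC.lastFactor_le_one)) ?_
    gcongr
    linarith
  · refine (errLast_le hne hC.prod_frob_nodes.le hε₂.1 hε₂.2 h).trans ?_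
    refine add_le_add (mul_le_mul_of_nonneg_left hC.lastCoeff_le hε₂.1) ?_
    gcongr
    linarith

end PEPS

/-! ### Tightness: PEPS that collapse to one entry -/

theorem one_add_sum_le_prod {ι : Type*} (s : Finset ι) {x : ι → ℝ} (hx : ∀ i, 0 ≤ x i) :
    1 + ∑ i ∈ s, x i ≤ ∏ i ∈ s, (1 + x i) := by
  classical
  induction s using Finset.induction_on with
  | empty => simp
  | insert a s ha ih =>
    rw [Finset.sum_insert ha, Finset.prod_insert ha]
    have h : 0 ≤ ∑ i ∈ s, x i := Finset.sum_nonneg fun i _ => hx i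
    nlinarith [hx a, mul_nonneg (hx a) h, mul_le_mul_of_nonneg_left ih (hx a)]

theorem exists_injective_map_eq {X Y : Type*} [Fintype X] [Fintype Y]
    (h : Fintype.card X ≤ Fintype.card Y) (x : X) (y : Y) :
    ∃ f : X → Y, Function.Injective f ∧ f x = y := by
  classical
  obtain ⟨f⟩ := Function.Embedding.nonempty_of_card_le h
  exact ⟨Equiv.swap (f x) y ∘ f, (Equiv.injective _).comp f.injective, by simp⟩

theorem isIsometric_of_injective {𝕜 r c : Type*} [RCLike 𝕜] [Fintype r] [DecidableEq r]
    [DecidableEq c] {f : c → r} (hf : Function.Injective f) :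
    IsIsometric (Matrix.of fun x y => if x = f y then (1 : 𝕜) else 0) := by
  ext y y'
  simp only [Matrix.mul_apply, Matrix.conjTranspose_apply, Matrix.of_apply, Matrix.one_apply]
  rw [Finset.sum_eq_single (f y') (fun x _ hx => by simp [hx]) (by simp)]
  by_cases h : y = y'
  · simp [h]
  · have : f y' ≠ f y := fun h' => h (hf h').symm
    simp [h, this]

namespace Chain

variable {𝕜 : Type*} [RCLike 𝕜] {n : ℕ} {B : Fin (n + 1) → Type} {P : Fin n → Type}
  [∀ k, Fintype (B k)] [∀ k, DecidableEq (B k)]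

/-- The last bond has only one index. If the right bond of a node is at `z`, a nonzero entry forces
its left bond to `z` as well, so by descent along the chain only the configuration `z` contributes.
Entries with other right indices are unconstrained, which leaves room for isometric nodes. -/
theorem contract_eq_prod [Subsingleton (B (Fin.last n))] {A : Chain 𝕜 B P} {z : ∀ k, B k}
    {w : ∀ k, P k → 𝕜}
    (h : ∀ k x q, A k (x, q, z k.succ) = if x = z k.castSucc then w k q else 0) (p : ∀ k, P k) :
    contract A p = ∏ k, w k (p k) := by
  rw [contract, Finset.sum_eq_single z _ (by simp)]
  · simp [h]
  · intro b _ hb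
    by_contra hne
    replace hne := Finset.prod_ne_zero_iff.1 hne
    refine hb (funext fun k => ?_)
    induction k using Fin.reverseInduction with
    | last => exact Subsingleton.elim _ _
    | cast k ih =>
      have hk := hne k (Finset.mem_univ _)
      rw [ih, h] at hk
      by_contra h'
      exact hk (if_neg h')

theorem contract_eq_ite [∀ k, DecidableEq (P k)] [Subsingleton (B (Fin.last n))]
    {A : Chain 𝕜 B P} {z : ∀ k, B k} {q₀ : ∀ k, P k} {a : Fin n → 𝕜}
    (h : ∀ k x q, A k (x, q, z k.succ) = if x = z k.castSucc ∧ q = q₀ k then a k else 0)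
    (p : ∀ k, P k) : contract A p = if p = q₀ then ∏ k, a k else 0 := by
  rw [contract_eq_prod (z := z) (w := fun k q => if q = q₀ k then a k else 0)
    fun k x q => by rw [h, ite_and]]
  split_ifs with hp
  · subst hp
    simp
  · obtain ⟨k, hk⟩ := Function.ne_iff.1 hp
    exact Finset.prod_eq_zero (Finset.mem_univ k) (if_neg hk)

end Chain

namespace Shape

variable {m n : ℕ} {S : Shape m n} (hS : S.Pos)

/-- The first index of the bonds to the left of a column. -/
def Pos.bond (k : Fin (n + 2)) : S.ColBond k := fun i => ⟨0, hS.2.1 i k⟩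

/-- The first index of the physical legs of a column. -/
def Pos.leg (j : Fin (n + 1)) : S.ColPhys j := fun i => ⟨0, hS.1 i j⟩

/-- The first index of a vertical bond. -/
def Pos.vbond (j : Fin (n + 1)) (k : Fin (m + 2)) : S.VerBond j k := ⟨0, hS.2.2 k j⟩

/-- The first index of the legs of a node that are not vertical. -/
def Pos.rowLegs (j : Fin (n + 1)) (i : Fin (m + 1)) : S.RowLegs j i :=
  (Pos.bond hS j.castSucc i, Pos.leg hS j i, Pos.bond hS j.succ i)

end Shape

theorem colTensor_eq_ite (hS : S.Pos) {j : Fin (n + 1)} {t : S.Column 𝕜 j} {a : Fin (m + 1) → 𝕜}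
    (h : ∀ i u q, t i (u, q, hS.vbond j i.succ) =
      if u = hS.vbond j i.castSucc ∧ q = hS.rowLegs j i then a i else 0)
    (x : S.ColBond j.castSucc) (q : S.ColPhys j) (y : S.ColBond j.succ) :
    colTensor t (x, q, y) =
      if x = hS.bond j.castSucc ∧ q = hS.leg j ∧ y = hS.bond j.succ then ∏ i, a i else 0 := by
  rw [colTensor, Chain.contract_eq_ite h]
  refine if_congr ?_ rfl rfl
  have hiff := (S.rowLegs_bijective j).1.eq_iff (a := (x, q, y))
    (b := (hS.bond j.castSucc, hS.leg j, hS.bond j.succ))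
  rw [Prod.mk.injEq, Prod.mk.injEq] at hiff
  exact hiff

namespace PEPS

/-- Fixing the right bonds of a column, or the lower bond of a node of the last column, to their
first index leaves only the first index of the other legs. -/
structure IsBased (hS : S.Pos) (T : S.PEPS 𝕜) : Prop where
  col : ∀ (j : Fin n) x q, columns T j.castSucc (x, q, hS.bond j.castSucc.succ) =
    if x = hS.bond j.castSucc.castSucc ∧ q = hS.leg j.castSucc then 1 else 0
  node : ∀ i u q, T (Fin.last n) i (u, q, hS.vbond (Fin.last n) i.succ) =
    if u = hS.vbond (Fin.last n) i.castSucc ∧ q = hS.rowLegs (Fin.last n) i then 1 else 0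

namespace IsBased

variable {hS : S.Pos} {T : S.PEPS 𝕜} (hT : IsBased hS T)
include hT

theorem contract_last : Chain.contract (T (Fin.last n)) = Pi.single (hS.rowLegs (Fin.last n)) 1 := by
  funext q
  rw [Chain.contract_eq_ite hT.node]
  simp [Pi.single_apply]

theorem tensor_eq : tensor T = Pi.single hS.leg 1 := by
  funext p
  rw [tensor, Chain.contract_eq_ite (z := hS.bond) (q₀ := hS.leg) (a := fun _ => 1)]
  · simp [Pi.single_apply]
  · intro j x q
    induction j using Fin.lastCases with
    | last =>
      rw [columns, colTensor_eq_ite hS hT.node]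
      simp
    | cast j => exact hT.col j x q

/-- The whole perturbation budget of each tensor is spent on its base entry. All contributions then
add with the same sign, and the error is a product of factors `1 + x` minus 1, which is at least the
sum of the `x`. -/
theorem exists_isPerturbation {ε₁ ε₂ : ℝ} (hε₁ : 0 ≤ ε₁) (hε₂ : 0 ≤ ε₂) :
    ∃ (Δ : ∀ j : Fin n, S.ColTensor 𝕜 j.castSucc) (δ : S.Column 𝕜 (Fin.last n)),
      IsPerturbation T ε₁ ε₂ Δ δ ∧
        ε₁ * ∑ j : Fin n, frob (columns T j.castSucc) + ε₂ * ∑ i, frob (T (Fin.last n) i) ≤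
          err T Δ δ := by
  let f : Fin n → ℝ := fun j => ε₁ * frob (columns T j.castSucc)
  let g : Fin (m + 1) → ℝ := fun i => ε₂ * frob (T (Fin.last n) i)
  have hf (j) : 0 ≤ f j := mul_nonneg hε₁ (frob_nonneg _)
  have hg (i) : 0 ≤ g i := mul_nonneg hε₂ (frob_nonneg _)
  let Δ : ∀ j : Fin n, S.ColTensor 𝕜 j.castSucc := fun j =>
    Pi.single (hS.bond j.castSucc.castSucc, hS.leg j.castSucc, hS.bond j.castSucc.succ) (f j : 𝕜)
  let δ : S.Column 𝕜 (Fin.last n) := fun i =>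
    Pi.single (hS.vbond (Fin.last n) i.castSucc, hS.rowLegs (Fin.last n) i,
      hS.vbond (Fin.last n) i.succ) (g i : 𝕜)
  have hδ (i u q) : (T (Fin.last n) + δ) i (u, q, hS.vbond (Fin.last n) i.succ) =
      if u = hS.vbond (Fin.last n) i.castSucc ∧ q = hS.rowLegs (Fin.last n) i then
        (1 + g i : 𝕜) else 0 := by
    simp only [Pi.add_apply, hT.node, δ, Pi.single_apply, Prod.mk.injEq, and_true]
    split_ifs <;> simp
  let a : Fin (n + 1) → 𝕜 := Fin.lastCases (∏ i, (1 + g i : 𝕜)) fun j => (1 + f j : 𝕜)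
  have hcontract : Chain.contract (perturbedColumns T Δ δ) = Pi.single hS.leg (∏ j, a j) := by
    funext p
    rw [Chain.contract_eq_ite (z := hS.bond) (q₀ := hS.leg) (a := a)]
    · simp [Pi.single_apply]
    · intro j x q
      induction j using Fin.lastCases with
      | last =>
        simp only [perturbedColumns, Fin.lastCases_last, a]
        rw [colTensor_eq_ite hS hδ]
        simp
      | cast j =>
        have h := hT.col j x q
        rw [columns] at h
        simp only [perturbedColumns, Fin.lastCases_castSucc, a, Pi.add_apply, h, Δ,
          Pi.single_apply, Prod.mk.injEq, and_true]
        split_ifs <;> simp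
  refine ⟨Δ, δ, ⟨fun j => ?_, fun i => ?_⟩, ?_⟩
  · simp only [Δ]
    rw [frob_single, RCLike.norm_of_nonneg (hf j)]
    rfl
  · simp only [δ]
    rw [frob_single, RCLike.norm_of_nonneg (hg i)]
  · rw [err, relErr, hcontract, hT.tensor_eq, ← Pi.single_sub, frob_single, frob_single, norm_one,
      div_one]
    have ha : ∏ j, a j = (((∏ j, (1 + f j)) * ∏ i, (1 + g i) : ℝ) : 𝕜) := by
      rw [Fin.prod_univ_castSucc]
      simp [a]
    have h₁ := one_add_sum_le_prod Finset.univ hf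
    have h₂ := one_add_sum_le_prod Finset.univ hg
    have h₃ : 0 ≤ ∑ j, f j := Finset.sum_nonneg fun j _ => hf j
    have h₄ : 0 ≤ ∑ i, g i := Finset.sum_nonneg fun i _ => hg i
    have h₅ := mul_le_mul h₁ h₂ (by positivity) (by linarith)
    have hsub (r : ℝ) : ‖(r : 𝕜) - 1‖ = |r - 1| := by
      rw [← RCLike.norm_ofReal (K := 𝕜), RCLike.ofReal_sub, RCLike.ofReal_one]
    rw [ha, hsub, Finset.mul_sum, Finset.mul_sum]
    refine le_trans ?_ (le_abs_self _)
    change ∑ j, f j + ∑ i, g i ≤ _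
    nlinarith [mul_nonneg h₃ h₄]

end IsBased

/-- The PEPS all of whose nodes are the first unit tensor. -/
def basePEPS (𝕜 : Type*) [RCLike 𝕜] (hS : S.Pos) : S.PEPS 𝕜 := fun j i =>
  Pi.single (hS.vbond j i.castSucc, hS.rowLegs j i, hS.vbond j i.succ) 1

theorem basePEPS_apply (hS : S.Pos) (j : Fin (n + 1)) (i : Fin (m + 1)) (u q) :
    basePEPS 𝕜 hS j i (u, q, hS.vbond j i.succ) =
      if u = hS.vbond j i.castSucc ∧ q = hS.rowLegs j i then 1 else 0 := by
  simp [basePEPS, Pi.single_apply]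

theorem columns_basePEPS (hS : S.Pos) (j : Fin (n + 1)) : columns (basePEPS 𝕜 hS) j =
    Pi.single (hS.bond j.castSucc, hS.leg j, hS.bond j.succ) 1 := by
  funext ⟨x, q, y⟩
  rw [columns, colTensor_eq_ite hS (basePEPS_apply hS j)]
  simp [Pi.single_apply]

theorem isBased_basePEPS (hS : S.Pos) : IsBased hS (basePEPS 𝕜 hS) where
  col j x q := by simp [columns_basePEPS, Pi.single_apply]
  node := basePEPS_apply hS _

theorem exists_tight (𝕜 : Type*) [RCLike 𝕜] (hS : S.Pos) :
    ∃ T : S.PEPS 𝕜, tensor T ≠ 0 ∧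
      ∃ K : ℝ, ∀ ε₁ ∈ Set.Icc (0 : ℝ) 1, ∀ ε₂ ∈ Set.Icc (0 : ℝ) 1,
        ∃ (Δ : ∀ j : Fin n, S.ColTensor 𝕜 j.castSucc) (δ : S.Column 𝕜 (Fin.last n)),
          IsPerturbation T ε₁ ε₂ Δ δ ∧
            |err T Δ δ - (ε₁ * colCoeff T + ε₂ * lastCoeff T * lastFactor T)| ≤
              K * (ε₁ ^ 2 + ε₂ ^ 2) := by
  have hT := isBased_basePEPS (𝕜 := 𝕜) hS
  set T := basePEPS 𝕜 hS with hTdef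
  have hne : tensor T ≠ 0 := by
    rw [hT.tensor_eq]
    simp
  have hF : frob (tensor T) = 1 := by rw [hT.tensor_eq, frob_single, norm_one]
  have hF' : frob (Chain.contract (T (Fin.last n))) = 1 := by
    rw [hT.contract_last, frob_single, norm_one]
  have hcol (j) : frob (columns T j) = 1 := by rw [hTdef, columns_basePEPS, frob_single, norm_one]
  have hnode (j i) : frob (T j i) = 1 := by rw [hTdef, basePEPS, frob_single, norm_one]
  have hcc : colCoeff T ≤ n := by
    rw [colCoeff, hF]
    simpa using Finset.sum_le_card_nsmul Finset.univ
      (fun j : Fin n => (columns T).envTerm j.castSucc) 1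
      fun j _ => Chain.envTerm_le_one (fun j => (hcol j).le) _
  have hlc : lastCoeff T ≤ m + 1 := by
    rw [lastCoeff, hF']
    simpa using Finset.sum_le_card_nsmul Finset.univ
      (fun i : Fin (m + 1) => Chain.envTerm (T (Fin.last n)) i) 1
      fun i _ => Chain.envTerm_le_one (fun i => (hnode _ i).le) _
  have hlf₀ : 0 ≤ lastFactor T :=
    div_nonneg (mul_nonneg (norm2_nonneg _) (frob_nonneg _)) (frob_nonneg _)
  have hlf : lastFactor T ≤ 1 := by
    have h : frob (colTensor (T (Fin.last n))) = 1 := hcol (Fin.last n)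
    rw [lastFactor, hF, h, mul_one, div_one]
    exact (Chain.norm2_leftBlock_le_prod (columns T) _).trans
      (Finset.prod_le_one (fun _ _ => frob_nonneg _) fun i _ => (hcol _).le)
  obtain ⟨K, hK₀, hK⟩ := exists_general_bound T hne
  -- One `K` comes from the bound on `err`, the other from substituting the bound on `errLast`.
  refine ⟨T, hne, 2 * K, fun ε₁ hε₁ ε₂ hε₂ => ?_⟩
  obtain ⟨Δ, δ, hpert, hlow⟩ := hT.exists_isPerturbation hε₁.1 hε₂.1
  refine ⟨Δ, δ, hpert, ?_⟩
  obtain ⟨h₁, h₂⟩ := hK ε₁ hε₁ ε₂ hε₂ Δ δ hpert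
  simp only [hcol, hnode, Finset.sum_const, Finset.card_univ, Fintype.card_fin, nsmul_eq_mul,
    mul_one] at hlow
  push_cast at hlow
  have h₃ := mul_le_mul_of_nonneg_right h₂ hlf₀
  have h₄ : K * ε₂ ^ 2 * lastFactor T ≤ K * ε₂ ^ 2 :=
    mul_le_of_le_one_right (by positivity) hlf
  have h₅ := mul_le_mul_of_nonneg_left hcc hε₁.1
  have h₆ : ε₂ * (lastCoeff T * lastFactor T) ≤ ε₂ * (m + 1) := by
    refine mul_le_mul_of_nonneg_left ?_ hε₂.1
    exact (mul_le_mul_of_nonneg_right hlc hlf₀).trans (mul_le_of_le_one_right (by positivity) hlf)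
  have h₇ : 0 ≤ K * ε₁ ^ 2 := by positivity
  have h₈ : 0 ≤ K * ε₂ ^ 2 := by positivity
  rw [abs_le]
  constructor <;> nlinarith

/-- Choose in each row an injection from right bond indices to pairs of a left bond index and a
physical index, sending base point to base point. Its 0/1 matrix is an isometry. The nodes are
supported on the first index of their vertical bonds, so the column is the tensor product of these
matrices. -/
theorem exists_isBased_column (𝕜 : Type*) [RCLike 𝕜] (hS : S.Pos) (j : Fin (n + 1))
    (h : ∀ i, S.hor i j.succ ≤ S.hor i j.castSucc * S.phys i j) :
    ∃ t : S.Column 𝕜 j,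
      IsIsometric (Matrix.of fun (x : S.ColBond j.castSucc × S.ColPhys j) y =>
        colTensor t (x.1, x.2, y)) ∧
      ∀ x q, colTensor t (x, q, hS.bond j.succ) =
        if x = hS.bond j.castSucc ∧ q = hS.leg j then 1 else 0 := by
  have hex (i : Fin (m + 1)) :
      ∃ f : Fin (S.hor i j.succ) → Fin (S.hor i j.castSucc) × Fin (S.phys i j),
        Function.Injective f ∧ f (hS.bond j.succ i) = (hS.bond j.castSucc i, hS.leg j i) :=
    exists_injective_map_eq (by simpa using h i) _ _
  choose f hf hf₀ using hex
  let w : ∀ i, S.RowLegs j i → 𝕜 := fun i q => if (q.1, q.2.1) = f i q.2.2 then 1 else 0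
  let t : S.Column 𝕜 j := fun i y =>
    if y.1 = hS.vbond j i.castSucc ∧ y.2.2 = hS.vbond j i.succ then w i y.2.1 else 0
  let F : S.ColBond j.succ → S.ColBond j.castSucc × S.ColPhys j := fun y =>
    (fun i => (f i (y i)).1, fun i => (f i (y i)).2)
  have ht (x q y) : colTensor t (x, q, y) = if (x, q) = F y then 1 else 0 := by
    rw [colTensor, Chain.contract_eq_prod (z := hS.vbond j) (w := w) (fun i u r => by simp [t])]
    have hiff : (x, q) = F y ↔ ∀ i, (x i, q i) = f i (y i) := by
      simp only [F, Prod.ext_iff, funext_iff, forall_and]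
    simp only [w]
    by_cases h : (x, q) = F y
    · rw [if_pos h]
      exact Finset.prod_eq_one fun i _ => if_pos (hiff.1 h i)
    · rw [if_neg h]
      obtain ⟨i, hi⟩ := not_forall.1 fun h' => h (hiff.2 h')
      exact Finset.prod_eq_zero (Finset.mem_univ i) (if_neg hi)
  refine ⟨t, ?_, fun x q => ?_⟩
  · simp only [ht]
    refine isIsometric_of_injective fun y y' hy => funext fun i => hf i ?_
    have hy := Prod.ext_iff.1 hy
    exact Prod.ext (congrFun hy.1 i) (congrFun hy.2 i)
  · rw [ht]
    simp only [F, hf₀, Prod.mk.injEq]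

theorem exists_isBased_node (𝕜 : Type*) [RCLike 𝕜] (hS : S.Pos) (j : Fin (n + 1))
    (i : Fin (m + 1)) (h : S.ver i.succ j ≤
      S.ver i.castSucc j * (S.hor i j.castSucc * (S.phys i j * S.hor i j.succ))) :
    ∃ t : S.VerBond j i.castSucc × S.RowLegs j i × S.VerBond j i.succ → 𝕜,
      IsIsometric (Matrix.of fun (x : S.VerBond j i.castSucc × S.RowLegs j i) y =>
        t (x.1, x.2, y)) ∧
      ∀ u q, t (u, q, hS.vbond j i.succ) =
        if u = hS.vbond j i.castSucc ∧ q = hS.rowLegs j i then 1 else 0 := by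
  obtain ⟨f, hf, hf₀⟩ := exists_injective_map_eq
    (X := S.VerBond j i.succ) (Y := S.VerBond j i.castSucc × S.RowLegs j i) (by simpa using h)
    (hS.vbond j i.succ) (hS.vbond j i.castSucc, hS.rowLegs j i)
  refine ⟨fun x => if (x.1, x.2.1) = f x.2.2 then 1 else 0, isIsometric_of_injective hf,
    fun u q => ?_⟩
  simp [hf₀]

theorem exists_isBased_isCanonical (𝕜 : Type*) [RCLike 𝕜] (hS : S.Pos) {D : ℕ}
    (hhor : ∀ (i : Fin (m + 1)) (j : Fin n), S.hor i j.castSucc.succ = D)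
    (hver : ∀ i : Fin m, S.ver i.castSucc.succ (Fin.last n) = D)
    (hphys : ∀ i : Fin (m + 1), D ≤ S.phys i 0) :
    ∃ C : S.PEPS 𝕜, IsCanonical C ∧ IsBased hS C := by
  -- These inequalities make the injections possible. In the first column the left bond is trivial,
  -- so the physical leg must supply `D`; in later columns the left bond does.
  have hD (j : Fin (n + 1)) (i) : D ≤ S.hor i j.castSucc * S.phys i j := by
    induction j using Fin.cases with
    | zero => exact (hphys i).trans (Nat.le_mul_of_pos_left _ (hS.2.1 i _))
    | succ j =>
      have : S.hor i j.succ.castSucc = D := hhor i j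
      rw [this]
      exact Nat.le_mul_of_pos_right _ (hS.1 i _)
  have hc (j : Fin n) := exists_isBased_column 𝕜 hS j.castSucc fun i => by
    rw [hhor]
    exact hD _ i
  choose t ht ht₀ using hc
  have hn (i : Fin (m + 1)) := exists_isBased_node 𝕜 hS (Fin.last n) i (by
    have hpos : 0 < S.hor i (Fin.last n).castSucc *
        (S.phys i (Fin.last n) * S.hor i (Fin.last n).succ) :=
      Nat.mul_pos (hS.2.1 i _) (Nat.mul_pos (hS.1 i _) (hS.2.1 i _))
    induction i using Fin.lastCases with
    | last =>
      have h1 : S.ver (Fin.last m).succ (Fin.last n) = 1 := S.ver_last _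
      rw [h1]
      exact Nat.mul_pos (hS.2.2 _ _) hpos
    | cast i =>
      rw [hver]
      refine (hD (Fin.last n) i.castSucc).trans ?_
      rw [← mul_assoc (S.hor _ _)]
      exact (Nat.le_mul_of_pos_right _ (hS.2.1 _ _)).trans
        (Nat.le_mul_of_pos_left _ (hS.2.2 _ _)))
  choose s hs hs₀ using hn
  let C : S.PEPS 𝕜 := Fin.lastCases (motive := fun j => S.Column 𝕜 j) s t
  have hCl : C (Fin.last n) = s := Fin.lastCases_last
  have hCc (j : Fin n) : C j.castSucc = t j := Fin.lastCases_castSucc _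
  refine ⟨C, ⟨fun j => ?_, fun i => ?_⟩, ⟨fun j => ?_, ?_⟩⟩
  · have h := ht j
    rw [← hCc] at h
    exact h
  · rw [hCl]
    exact hs i.castSucc
  · rw [columns, hCc]
    exact ht₀ j
  · rw [hCl]
    exact hs₀

theorem exists_canonical_tight (𝕜 : Type*) [RCLike 𝕜] (hS : S.Pos) {D : ℕ}
    (hhor : ∀ (i : Fin (m + 1)) (j : Fin n), S.hor i j.castSucc.succ = D)
    (hver : ∀ i : Fin m, S.ver i.castSucc.succ (Fin.last n) = D)
    (hphys : ∀ i : Fin (m + 1), D ≤ S.phys i 0) :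
    ∃ C : S.PEPS 𝕜, tensor C ≠ 0 ∧ IsCanonical C ∧
      ∃ K : ℝ, ∀ ε₁ ∈ Set.Icc (0 : ℝ) 1, ∀ ε₂ ∈ Set.Icc (0 : ℝ) 1,
        ∃ (Δ : ∀ j : Fin n, S.ColTensor 𝕜 j.castSucc) (δ : S.Column 𝕜 (Fin.last n)),
          IsPerturbation C ε₁ ε₂ Δ δ ∧
            |err C Δ δ - (ε₁ * canonColCoeff C + ε₂ * canonLastCoeff C)| ≤
              K * (ε₁ ^ 2 + ε₂ ^ 2) ∧
            |err C Δ δ -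
              (ε₁ * (n * (D : ℝ) ^ ((m + 1 : ℝ) / 2)) + ε₂ * (1 + m * √(D : ℝ)))| ≤
              K * (ε₁ ^ 2 + ε₂ ^ 2) := by
  obtain ⟨C, hC, hB⟩ := exists_isBased_isCanonical 𝕜 hS hhor hver hphys
  have hne : tensor C ≠ 0 := by
    rw [hB.tensor_eq]
    simp
  obtain ⟨K, hK₀, hK⟩ := exists_canonical_bound 𝕜 S D fun i => (hver i).le
  have hcol : ∑ j : Fin n, frob (columns C j.castSucc) = n * (D : ℝ) ^ ((m + 1 : ℝ) / 2) := by
    simp [hC.frob_column, hhor, ← sqrt_pow_eq_rpow]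
  have hnode : ∑ i, frob (C (Fin.last n) i) = 1 + m * √(D : ℝ) := by
    -- The summand 1 is the center node, whose norm is that of the contracted column, a unit tensor.
    rw [Fin.sum_univ_castSucc, ← hC.frob_contract_last, hB.contract_last, frob_single, norm_one,
      add_comm]
    simp [hC.frob_node, hver]
  refine ⟨C, hne, hC, 2 * K, fun ε₁ hε₁ ε₂ hε₂ => ?_⟩
  obtain ⟨Δ, δ, hpert, hlow⟩ := hB.exists_isPerturbation hε₁.1 hε₂.1
  obtain ⟨h₁, h₂⟩ := hK C hne hC ε₁ hε₁ ε₂ hε₂ Δ δ hpert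
  rw [hcol, hnode] at hlow
  have h₃ := mul_le_mul_of_nonneg_left (hC.canonColCoeff_le fun i j => (hhor i j).le) hε₁.1
  have h₄ := mul_le_mul_of_nonneg_left (hC.canonLastCoeff_le fun i => (hver i).le) hε₂.1
  have h₅ : 0 ≤ K * ε₁ ^ 2 := by positivity
  have h₆ : 0 ≤ K * ε₂ ^ 2 := by positivity
  -- The lower bound uses the dimension-only coefficients, the upper bound the canonical ones, which
  -- are no larger; the error is therefore within second order of both.
  refine ⟨Δ, δ, hpert, ?_, ?_⟩ <;> rw [abs_le] <;> constructor <;> linarith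

end PEPS

end TensorNet

/-! ### Assembly of the four statements -/

theorem mainTheorem9 (𝕜 : Type*) [RCLike 𝕜] (m n : ℕ) (S : Shape m n) :
    -- general PEPS: upper bound
    (∀ T : S.PEPS 𝕜, PEPS.tensor T ≠ 0 →
      ∃ K : ℝ, ∀ ε₁ ∈ Set.Icc (0 : ℝ) 1, ∀ ε₂ ∈ Set.Icc (0 : ℝ) 1,
        ∀ (Δ : ∀ j : Fin n, S.ColTensor 𝕜 j.castSucc) (δ : S.Column 𝕜 (Fin.last n)),
          PEPS.IsPerturbation T ε₁ ε₂ Δ δ →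
            PEPS.err T Δ δ ≤
              ε₁ * PEPS.colCoeff T
                + PEPS.errLast T δ * PEPS.lastFactor T
                + K * (ε₁ ^ 2 + ε₂ ^ 2) ∧
            PEPS.errLast T δ ≤ ε₂ * PEPS.lastCoeff T + K * ε₂ ^ 2) ∧
    -- general PEPS: tightness
    (S.Pos →
      ∃ T : S.PEPS 𝕜, PEPS.tensor T ≠ 0 ∧
        ∃ K : ℝ, ∀ ε₁ ∈ Set.Icc (0 : ℝ) 1, ∀ ε₂ ∈ Set.Icc (0 : ℝ) 1,
          ∃ (Δ : ∀ j : Fin n, S.ColTensor 𝕜 j.castSucc) (δ : S.Column 𝕜 (Fin.last n)),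
            PEPS.IsPerturbation T ε₁ ε₂ Δ δ ∧
            |PEPS.err T Δ δ -
              (ε₁ * PEPS.colCoeff T
                + ε₂ * PEPS.lastCoeff T * PEPS.lastFactor T)|
              ≤ K * (ε₁ ^ 2 + ε₂ ^ 2)) ∧
    -- canonical PEPS: upper bounds
    (∀ D : ℕ, (∀ (i : Fin (m + 1)) (j : Fin n), S.hor i j.castSucc.succ ≤ D) →
      (∀ i : Fin m, S.ver i.castSucc.succ (Fin.last n) ≤ D) →
      ∃ K : ℝ, ∀ C : S.PEPS 𝕜, PEPS.tensor C ≠ 0 → PEPS.IsCanonical C →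
        (∀ ε₁ ∈ Set.Icc (0 : ℝ) 1, ∀ ε₂ ∈ Set.Icc (0 : ℝ) 1,
          ∀ (Δ : ∀ j : Fin n, S.ColTensor 𝕜 j.castSucc) (δ : S.Column 𝕜 (Fin.last n)),
            PEPS.IsPerturbation C ε₁ ε₂ Δ δ →
              PEPS.err C Δ δ ≤
                ε₁ * PEPS.canonColCoeff C + PEPS.errLast C δ
                  + K * (ε₁ ^ 2 + ε₂ ^ 2) ∧
              PEPS.err C Δ δ ≤
                ε₁ * (1 + n * (D : ℝ) ^ ((m + 1 : ℝ) / 2)) + PEPS.errLast C δ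
                  + K * (ε₁ ^ 2 + ε₂ ^ 2) ∧
              PEPS.errLast C δ ≤
                ε₂ * PEPS.canonLastCoeff C + K * ε₂ ^ 2) ∧
        PEPS.canonColCoeff C ≤ n * (D : ℝ) ^ ((m + 1 : ℝ) / 2) ∧
        PEPS.canonLastCoeff C ≤ 1 + m * √(D : ℝ)) ∧
    -- canonical PEPS: tightness
    (∀ D : ℕ, S.Pos → (∀ (i : Fin (m + 1)) (j : Fin n), S.hor i j.castSucc.succ = D) →
      (∀ i : Fin m, S.ver i.castSucc.succ (Fin.last n) = D) →
      (∀ i : Fin (m + 1), D ≤ S.phys i 0) →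
      ∃ C : S.PEPS 𝕜, PEPS.tensor C ≠ 0 ∧ PEPS.IsCanonical C ∧
        ∃ K : ℝ, ∀ ε₁ ∈ Set.Icc (0 : ℝ) 1, ∀ ε₂ ∈ Set.Icc (0 : ℝ) 1,
          ∃ (Δ : ∀ j : Fin n, S.ColTensor 𝕜 j.castSucc) (δ : S.Column 𝕜 (Fin.last n)),
            PEPS.IsPerturbation C ε₁ ε₂ Δ δ ∧
            |PEPS.err C Δ δ -
              (ε₁ * PEPS.canonColCoeff C + ε₂ * PEPS.canonLastCoeff C)|
              ≤ K * (ε₁ ^ 2 + ε₂ ^ 2) ∧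
            |PEPS.err C Δ δ -
              (ε₁ * (n * (D : ℝ) ^ ((m + 1 : ℝ) / 2)) + ε₂ * (1 + m * √(D : ℝ)))|
              ≤ K * (ε₁ ^ 2 + ε₂ ^ 2)) := by
  refine ⟨fun T hT => ?_, fun hS => PEPS.exists_tight 𝕜 hS, fun D hhor hver => ?_,
    fun D hS hhor hver hphys => PEPS.exists_canonical_tight 𝕜 hS hhor hver hphys⟩
  · obtain ⟨K, -, hK⟩ := PEPS.exists_general_bound T hT
    exact ⟨K, hK⟩
  · obtain ⟨K, hK₀, hK⟩ := PEPS.exists_canonical_bound 𝕜 S D hver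
    refine ⟨K, fun C hne hC => ⟨fun ε₁ hε₁ ε₂ hε₂ Δ δ h => ?_, hC.canonColCoeff_le hhor,
      hC.canonLastCoeff_le hver⟩⟩
    obtain ⟨h₁, h₂⟩ := hK C hne hC ε₁ hε₁ ε₂ hε₂ Δ δ h
    refine ⟨h₁, h₁.trans ?_, h₂⟩
    have h₃ := mul_le_mul_of_nonneg_left (hC.canonColCoeff_le hhor) hε₁.1
    have h₄ := hε₁.1
    linarith
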